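/- Let $x=(x_1,x_2,\ldots)$ and $\theta=(\theta_1,\theta_2,\ldots)$ satisfy $x_ix_j=x_jx_i$, $x_i\theta_j=\theta_jx_i$, $\theta_i\theta_j=-\theta_j\theta_i$ (so $\theta_i^2=0$), and work in the $\mathbb{Q}$-algebra of formal power series of bounded degree in these variables. A dotted composition is a finite sequence $\alpha=(\alpha_1,\ldots,\alpha_k)$ whose components are positive integers or dotted nonnegative integers $\dot a$. Put $$M_\alpha=\sum_{i_1<\cdots<i_k}\theta_{i_1}^{\epsilon_1}\cdots\theta_{i_k}^{\epsilon_k}x_{i_1}^{a_1}\cdots x_{i_k}^{a_k},\qquad L_\alpha=\sum_{\beta\preceq\alpha}M_\beta,$$ where $(\epsilon_t,a_t)=(0,a)$ if $\alpha_t=a$ and $(\epsilon_t,a_t)=(1,a)$ if $\alpha_t=\dot a$, and where $\preceq$ is the partial order generated by: $\beta\succ\alpha$ if $\beta$ arises from $\alpha$ by replacing two adjacent non-dotted components by their sum. A set supercomposition of size $n$ is a finite sequence $I=(I_1,\ldots,I_k)$ of nonempty subsets (blocks) of $\{0,1,\ldots,n\}$ such that every element of $\{1,\ldots,n\}$ lies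 in exactly one block; blocks containing $0$ are called fermionic. It is a superpermutation if every non-fermionic block is a singleton. For a superpermutation $I$, $\gamma(I)$ is the dotted composition obtained by concatenating, in order of appearance, the part $\dot a$ with $a=|I_i|-1$ for each fermionic block $I_i$, and, for each maximal sequence $\{a_p\},\ldots,\{a_q\}$ of consecutive non-fermionic blocks, the descent composition of the word $a_p\cdots a_q$. Let $I$ (of size $n$) and $J$ be superpermutations, and let $J[n]$ be obtained from $J$ by adding $n$ to all positive elements. An $(I,J)$-shuffle $L$ is a sequence consisting of the blocks of $I$ and of $J[n]$, in which the blocks of $I$ and those of $J[n]$ keep their order; its sign is $(-1)^{\varepsilon(L)}$, where $\varepsilon(L)$ is the number of pairs of a fermionic block of $I$ and a fermionic block of $J[n]$ such that the latter precedes the former in $L$. An $(I,J)$-super-shuffle $K$ is obtained from an $(I,J)$-shuffle $L$ by a possibly empty collection of disjoint mergers of consecutive blocks $L_p,\ldots,L_q$ into their union, where either $L_p$ is a fermionic block of $I$ and $L_{p+1},\ldots,L_q$ are non-fermionic blocks of $J[n]$, or $L_q$ is a fermionic block of $J[n]$ and $L_p,\ldots,L_{q-1}$ are non-fermionic blocks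 of $I$, and where the elements of the non-fermionic blocks that are merged increase from left to right. Put $\operatorname{sgn}(K)=(-1)^{\varepsilon(L)}$. Let $\operatorname{SSh}(I,J)$ be the collection of all $(I,J)$-super-shuffles, where the blocks are labelled by their origin ($I$ or $J$), so that the same sequence of sets obtained from different shuffles is counted separately. **Theorem.** Let $\alpha$ and $\beta$ be dotted compositions. Then, for any superpermutations $I$ and $J$ with $\gamma(I)=\alpha$ and $\gamma(J)=\beta$, $$L_\alpha L_\beta=\sum_{K\in\operatorname{SSh}(I,J)}\operatorname{sgn}(K)\,L_{\gamma(K)}.$$ Moreover, the right-hand side depends only on $\alpha$ and $\beta$. -/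

import Mathlib

namespace SuperQSym

/-! ### Power series in superspace -/

/-- The normal-form monomial `θ_{s₁} ⋯ θ_{sₘ} · ∏ x_i ^ (e i)` with `s₁ < ⋯ < sₘ` is encoded by the
pair `(S, e)`, `S = {s₁, …, sₘ}`. The two countable ordered families of variables are indexed
by `ℕ`, so the customary `x₁, x₂, …` are here `x₀, x₁, …`. -/
abbrev SMonomial : Type := Finset ℕ × (ℕ →₀ ℕ)

/-- Total degree in the `x` and the `θ`. -/
noncomputable def SMonomial.degree (u : SMonomial) : ℕ := u.1.card + u.2.degree

/-- The space of formal power series of bounded degree, given by their coefficients on the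
normal-form monomials. -/
def boundedSeries : Submodule ℚ (SMonomial → ℚ) where
  carrier := {f | ∃ d : ℕ, ∀ u : SMonomial, d < u.degree → f u = 0}
  zero_mem' := ⟨0, fun _ _ => rfl⟩
  add_mem' := by
    rintro f g ⟨d, hd⟩ ⟨e, he⟩
    refine ⟨max d e, fun u hu => ?_⟩
    have h1 := hd u (lt_of_le_of_lt (le_max_left _ _) hu)
    have h2 := he u (lt_of_le_of_lt (le_max_right _ _) hu)
    simp [h1, h2]
  smul_mem' := by
    rintro c f ⟨d, hd⟩
    refine ⟨d, fun u hu => ?_⟩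
    simp [hd u hu]

/-- Power series of bounded degree in commuting `x` and anticommuting `θ`, over `ℚ`. -/
abbrev SuperSeries : Type := boundedSeries

/-- For disjoint `A` and `B`, the sign with `θ_A θ_B = thetaSign A B · θ_{A ∪ B}`, where `θ_S` is the
product of the `θ_s`, `s ∈ S`, in increasing order of `s`. -/
def thetaSign (A B : Finset ℕ) : ℚ :=
  (-1) ^ ((A ×ˢ B).filter (fun p => p.2 < p.1)).card

/-- The coefficients of a product; products of monomials sharing a `θ` vanish. -/
noncomputable def mulCoeff (f g : SMonomial → ℚ) (u : SMonomial) : ℚ :=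
  ∑ A ∈ u.1.powerset, ∑ p ∈ Finset.HasAntidiagonal.antidiagonal u.2,
    thetaSign A (u.1 \ A) * (f (A, p.1) * g (u.1 \ A, p.2))

theorem mulCoeff_mem (f g : SuperSeries) : mulCoeff f.1 g.1 ∈ boundedSeries := by
  obtain ⟨f, d, hd⟩ := f
  obtain ⟨g, e, he⟩ := g
  refine ⟨d + e, fun u hu => ?_⟩
  refine Finset.sum_eq_zero fun A hA => Finset.sum_eq_zero fun p hp => ?_
  have hc : A.card + (u.1 \ A).card = u.1.card := by
    rw [add_comm]
    exact Finset.card_sdiff_add_card_eq_card (Finset.mem_powerset.1 hA)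
  have hp' : p.1.degree + p.2.degree = u.2.degree := by
    rw [← Finset.HasAntidiagonal.mem_antidiagonal.1 hp, map_add]
  simp only [SMonomial.degree] at hu
  by_cases h : d < A.card + p.1.degree
  · simp [hd (A, p.1) h]
  · have h' : e < (u.1 \ A).card + p.2.degree := by omega
    simp [he (u.1 \ A, p.2) h']

noncomputable instance : Mul SuperSeries := ⟨fun f g => ⟨mulCoeff f.1 g.1, mulCoeff_mem f g⟩⟩

/-! ### Dotted compositions -/

/-- A component of a dotted composition: a positive integer, or a dotted nonnegative integer. -/
inductive DottedPart : Type
  | plain (a : ℕ+) : DottedPart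
  | dotted (a : ℕ) : DottedPart

/-- The underlying integer of a component. -/
def DottedPart.val : DottedPart → ℕ
  | .plain a => a
  | .dotted a => a

/-- Whether a component is dotted. -/
def DottedPart.isDotted : DottedPart → Bool
  | .plain _ => false
  | .dotted _ => true

/-- Dotted compositions. -/
abbrev DottedComposition : Type := List DottedPart

/-- The monomial `∏ₜ θ_{i t}` (over the dotted `αₜ`) times `∏ₜ x_{i t} ^ αₜ`. -/
noncomputable def monomialAt (α : DottedComposition) (i : Fin α.length ↪o ℕ) : SMonomial :=
  ((Finset.univ.filter (fun t => (α.get t).isDotted = true)).image i,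
    ∑ t, Finsupp.single (i t) (α.get t).val)

/-- The monomial quasisymmetric function `M_α = ∑_{i₁ < ⋯ < iₖ} monomialAt α i` as a formal sum:
the coefficient of `u` is the number of index sequences `i` (at most one) whose monomial is `u`. -/
noncomputable def monomialQSym (α : DottedComposition) : SuperSeries :=
  ⟨fun u => (Nat.card {i : Fin α.length ↪o ℕ // monomialAt α i = u} : ℚ), by
    refine ⟨α.length + ∑ t, (α.get t).val, fun u hu => ?_⟩
    have : IsEmpty {i : Fin α.length ↪o ℕ // monomialAt α i = u} := by
      refine ⟨fun ⟨i, hi⟩ => ?_⟩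
      subst hi
      refine absurd hu (not_lt.2 (Nat.add_le_add ?_ ?_))
      · refine Finset.card_image_le.trans ((Finset.card_filter_le _ _).trans ?_)
        simp
      · simp [monomialAt, map_sum, Finsupp.degree_single]
    simp⟩

/-- `β` covers `α`: two adjacent non-dotted components of `α` are added to give `β`. -/
def Covers (β α : DottedComposition) : Prop :=
  ∃ (l r : DottedComposition) (a b : ℕ+),
    α = l ++ [DottedPart.plain a, DottedPart.plain b] ++ r ∧ β = l ++ [DottedPart.plain (a + b)] ++ r

/-- The partial order `β ≼ α` on dotted compositions. -/
def Preceq (β α : DottedComposition) : Prop :=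
  Relation.ReflTransGen (fun δ ε => Covers ε δ) β α

/-- An auxiliary statistic that is constant on intervals, used for finiteness only. -/
def weight (α : DottedComposition) : ℕ :=
  (α.map fun p => p.val + if p.isDotted then 1 else 0).sum

theorem finite_lists {T : Type*} {S : Set T} (hS : S.Finite) (N : ℕ) :
    {l : List T | l.length ≤ N ∧ ∀ x ∈ l, x ∈ S}.Finite := by
  have : Finite S := hS
  refine ((List.finite_length_le S N).image (List.map Subtype.val)).subset ?_
  rintro l ⟨hl, hx⟩
  lift l to List S using hx
  exact ⟨l, by simpa using hl, rfl⟩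

theorem finite_preceq (α : DottedComposition) : {β | Preceq β α}.Finite := by
  have hw : ∀ β, Preceq β α → weight β = weight α := by
    intro β h
    induction h with
    | refl => rfl
    | tail _ h ih =>
      obtain ⟨l, r, a, b, rfl, rfl⟩ := h
      rw [ih]
      simp [weight, DottedPart.val, DottedPart.isDotted]
      omega
  have hS : {p : DottedPart | p.val ≤ weight α}.Finite := by
    refine (((Set.finite_Iic (weight α)).image fun a => DottedPart.plain a.toPNat').union
      ((Set.finite_Iic (weight α)).image DottedPart.dotted)).subset ?_
    rintro (a | a) h
    · exact Or.inl ⟨a, h, by simp⟩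
    · exact Or.inr ⟨a, h, rfl⟩
  refine (finite_lists hS (weight α)).subset fun β hβ => ?_
  rw [← hw β hβ]
  clear hβ
  have key : ∀ p : DottedPart, 1 ≤ p.val + if p.isDotted then 1 else 0 := by
    rintro (a | a)
    · exact a.2
    · simp [DottedPart.isDotted]
  induction β with
  | nil => simp
  | cons p β ih =>
    have e : weight (p :: β) = (p.val + if p.isDotted then 1 else 0) + weight β := by
      simp [weight]
    have hp := key p
    refine ⟨by have := ih.1; simp only [List.length_cons]; omega, ?_⟩
    intro x hx
    rcases List.mem_cons.1 hx with rfl | hx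
    · simp only [Set.mem_ofPred_eq]; omega
    · have := ih.2 x hx
      simp only [Set.mem_ofPred_eq] at this ⊢
      omega

/-- The fundamental quasisymmetric function in superspace `L_α = ∑_{β ≼ α} M_β`. -/
noncomputable def fundamental (α : DottedComposition) : SuperSeries :=
  ∑ β ∈ (finite_preceq α).toFinset, monomialQSym β

/-! ### Set supercompositions and superpermutations -/

/-- A set supercomposition of `[n]`: its blocks may share the element `0` only, and `0` marks the
fermionic blocks. -/
structure SetSupercomposition where
  /-- the size `n` (the first component of the bidegree) -/
  n : ℕ
  /-- the sequence of blocks -/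
  blocks : List (Finset ℕ)
  nonempty : ∀ B ∈ blocks, B.Nonempty
  union : ∀ a : ℕ, a ≠ 0 → ((∃ B ∈ blocks, a ∈ B) ↔ a ≤ n)
  inter : blocks.Pairwise fun B C => B ∩ C ⊆ {0}

/-- Fermionic blocks. -/
abbrev Fermionic (B : Finset ℕ) : Prop := 0 ∈ B

/-- A superpermutation: every non-fermionic block is a singleton. -/
def SetSupercomposition.IsSuperpermutation (I : SetSupercomposition) : Prop :=
  ∀ B ∈ I.blocks, ¬ Fermionic B → B.card = 1

/-- For nonempty blocks: `max B < min C`. -/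
abbrev Below (B C : Finset ℕ) : Prop := ∀ b ∈ B, ∀ c ∈ C, b < c

/-- An increasing sequence of non-fermionic blocks. -/
def IncreasingSeq (s : List (Finset ℕ)) : Prop :=
  (∀ B ∈ s, ¬ Fermionic B) ∧ s.IsChain Below

/-- The dotted composition `γ` of a superpermutation with the given blocks. Each fermionic block is
cut off on its own and gives a dotted part; each non-fermionic segment is cut at its descents, and
the lengths of the (nonempty) pieces are the components of its descent composition. -/
def gammaBlocks (s : List (Finset ℕ)) : DottedComposition :=
  (s.splitBy fun B C => decide (¬ Fermionic B ∧ ¬ Fermionic C ∧ Below B C)).map fun run =>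
    match run with
    | [] => DottedPart.plain 1 -- does not occur
    | B :: rest => if Fermionic B then DottedPart.dotted (B.card - 1)
        else DottedPart.plain (Nat.succPNat rest.length)

/-- The dotted composition `γ(I)` of a superpermutation `I`. -/
def SetSupercomposition.gamma (I : SetSupercomposition) : DottedComposition :=
  gammaBlocks I.blocks

/-! ### Super-shuffles -/

/-- The `n`-shift of a block: `n` is added to every positive element. -/
def shiftBlock (n : ℕ) (B : Finset ℕ) : Finset ℕ :=
  B.image fun a => if a = 0 then 0 else a + n

/-- A block together with its origin: `inl` for a block of `I`, `inr` for a block of `J[n]`. -/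
abbrev OBlock : Type := Finset ℕ ⊕ Finset ℕ

/-- The set underlying a block with origin. -/
def OBlock.set : OBlock → Finset ℕ := Sum.elim id id

/-- `L` is an `(I, J)`-shuffle, the origin of each block being recorded. -/
def IsShuffle (I J : SetSupercomposition) (L : List OBlock) : Prop :=
  L.filterMap Sum.getLeft? = I.blocks ∧
    L.filterMap Sum.getRight? = J.blocks.map (shiftBlock I.n)

/-- `ε(L)`: the number of pairs of a fermionic block of `J[n]` and a fermionic block of `I` such
that the former precedes the latter in `L`. -/
def inversions : List OBlock → ℕ
  | [] => 0
  | .inl _ :: L => inversions L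
  | .inr F :: L =>
      (if Fermionic F then (L.filterMap Sum.getLeft?).countP (fun B => decide (Fermionic B)) else 0)
        + inversions L

/-- The groups of consecutive blocks that are united in a super-shuffle: a block on its own, or a
fermionic block of `I` followed by an increasing sequence of `J`, or an increasing sequence of `I`
followed by a fermionic block of `J`. -/
def IsGroup (g : List OBlock) : Prop :=
  (∃ b, g = [b]) ∨
  (∃ (F : Finset ℕ) (s : List (Finset ℕ)), Fermionic F ∧ IncreasingSeq s ∧
    g = Sum.inl F :: s.map Sum.inr) ∨
  (∃ (F : Finset ℕ) (s : List (Finset ℕ)), Fermionic F ∧ IncreasingSeq s ∧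
    g = s.map Sum.inl ++ [Sum.inr F])

/-- `K` is an `(I, J)`-super-shuffle: a shuffle (the concatenation of `K`) with a division into
groups, each of which is to be united. Origins are kept, so that two super-shuffles with the same
sequence of blocks are distinct if they come from distinct shuffles. -/
def IsSuperShuffle (I J : SetSupercomposition) (K : List (List OBlock)) : Prop :=
  IsShuffle I J K.flatten ∧ ∀ g ∈ K, IsGroup g

/-- The sequence of blocks of a super-shuffle: each group is replaced by its union. -/
def superShuffleBlocks (K : List (List OBlock)) : List (Finset ℕ) :=
  K.map fun g => (g.map OBlock.set).foldr (· ∪ ·) ∅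

/-- The sign of a super-shuffle. -/
def superShuffleSign (K : List (List OBlock)) : ℚ := (-1) ^ inversions K.flatten

theorem length_flatten_le (K : List (List OBlock)) (h : ∀ g ∈ K, IsGroup g) :
    K.length ≤ K.flatten.length ∧ ∀ g ∈ K, g.length ≤ K.flatten.length := by
  induction K with
  | nil => simp
  | cons g K ih =>
    obtain ⟨h1, h2⟩ := ih fun g hg => h g (List.mem_cons_of_mem _ hg)
    have hg : 1 ≤ g.length := by
      rcases h g List.mem_cons_self with ⟨b, rfl⟩ | ⟨F, s, _, _, rfl⟩ | ⟨F, s, _, _, rfl⟩ <;> simp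
    simp only [List.length_cons, List.flatten_cons, List.length_append, List.mem_cons]
    refine ⟨by omega, ?_⟩
    rintro g' (rfl | hg')
    · omega
    · have := h2 g' hg'
      omega

theorem length_eq_of_isShuffle (L : List OBlock) :
    L.length = (L.filterMap Sum.getLeft?).length + (L.filterMap Sum.getRight?).length := by
  induction L with
  | nil => rfl
  | cons b L ih =>
    rcases b with b | b
    · simp only [List.filterMap_cons, Sum.getLeft?, Sum.getRight?, List.length_cons, ih]
      omega
    · simp only [List.filterMap_cons, Sum.getLeft?, Sum.getRight?, List.length_cons, ih]
      omega

theorem finite_superShuffles (I J : SetSupercomposition) : {K | IsSuperShuffle I J K}.Finite := by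
  set N := I.blocks.length + J.blocks.length
  let S : Set OBlock := Sum.inl '' {B | B ∈ I.blocks} ∪
    Sum.inr '' {B | B ∈ J.blocks.map (shiftBlock I.n)}
  have hS : S.Finite := ((List.finite_toSet _).image _).union ((List.finite_toSet _).image _)
  refine (finite_lists (finite_lists hS N) N).subset ?_
  rintro K ⟨⟨hl, hr⟩, hK⟩
  have hN : K.flatten.length = N := by
    rw [length_eq_of_isShuffle, hl, hr, List.length_map]
  obtain ⟨h1, h2⟩ := length_flatten_le K hK
  refine ⟨by omega, fun g hg => ⟨by have := h2 g hg; omega, fun b hb => ?_⟩⟩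
  have hb' : b ∈ K.flatten := List.mem_flatten.2 ⟨g, hg, hb⟩
  rcases b with b | b
  · refine Or.inl ⟨b, ?_, rfl⟩
    rw [Set.mem_ofPred_eq, ← hl]
    exact List.mem_filterMap.2 ⟨_, hb', rfl⟩
  · refine Or.inr ⟨b, ?_, rfl⟩
    rw [Set.mem_ofPred_eq, ← hr]
    exact List.mem_filterMap.2 ⟨_, hb', rfl⟩

/-- The finite set `SSh(I, J)` of `(I, J)`-super-shuffles. -/
noncomputable def superShuffles (I J : SetSupercomposition) : Finset (List (List OBlock)) :=
  (finite_superShuffles I J).toFinset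

end SuperQSym

/-!
The coefficient of a monomial in `fundamental (gammaBlocks s)` is `0` or `1`: it counts the ways to
place the blocks of `s` on the variables in weakly increasing order, such that the blocks on one
variable are an increasing sequence of non-fermionic blocks, or a single fermionic block. If a
monomial is read as a word with one letter for each variable (`SWord.monomial`), this coefficient is
computed letter by letter (`place`, `fundamental_gammaBlocks_apply`). Likewise, the coefficients of a
product are obtained by distributing each letter among the two factors (`mulWord`,
`mulCoeff_monomial`), where a `θ` of the second factor passes the later `θ`s of the first one.

The product rule then follows by induction on the word, for arbitrary sequences of blocks `I`, `J`
whose non-fermionic blocks are singletons and which share no positive elements (`mulWord_place`). If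
the first variable carries no `θ`, it receives a run of `I` and a run of `J`. There is exactly one
way to shuffle them to an increasing sequence, and this is the run that the super-shuffle puts on
the variable (`mulRun_succ` and `shuffleRun_succ` remove its smallest block). If the first variable
carries a `θ`, it receives a fermionic block of the one sequence and a run of the other, and these
form the first group of the super-shuffle (`mulWord_theta_left`, `mulWord_theta_right`,
`sum_superShufflesOf_theta`). A fermionic block of `J` there precedes all remaining fermionic blocks
of `I`, which are as many as the `θ`s that it passes (`neg_one_pow_mul_place`); so the signs agree.

The sum over the super-shuffles is thus `L_α L_β`, whatever `I` and `J` are.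
-/

namespace SuperQSym

open Finset

/-! ### Coefficients of the fundamental functions -/

/-- The indices of the variables that occur in a monomial. -/
def SMonomial.support (u : SMonomial) : Finset ℕ := u.1 ∪ u.2.support

/-- The component of a dotted composition that records how the variables `θ_t` and `x_t` occur
in `u`; meaningful for `t` in the support only. -/
def SMonomial.part (u : SMonomial) (t : ℕ) : DottedPart :=
  if t ∈ u.1 then .dotted (u.2 t) else .plain (u.2 t).toPNat'

/-- The dotted composition of a monomial: its parts, by increasing index of the variables. -/
def SMonomial.comp (u : SMonomial) : DottedComposition := u.support.sort.map u.part

theorem monomialAt_fst_mem (α : DottedComposition) (i : Fin α.length ↪o ℕ) (t : Fin α.length) :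
    i t ∈ (monomialAt α i).1 ↔ (α.get t).isDotted = true := by
  simp [monomialAt]

theorem monomialAt_snd_apply (α : DottedComposition) (i : Fin α.length ↪o ℕ) (t : Fin α.length) :
    (monomialAt α i).2 (i t) = (α.get t).val := by
  simp [monomialAt, Finsupp.finsetSum_apply, Finsupp.single_apply]

theorem support_monomialAt (α : DottedComposition) (i : Fin α.length ↪o ℕ) :
    (monomialAt α i).support = univ.map i.toEmbedding := by
  ext n
  constructor
  · intro h
    rw [SMonomial.support, mem_union, Finsupp.mem_support_iff] at h
    simp only [mem_map, mem_univ, true_and]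
    by_contra! hn
    rcases h with h | h
    · simp only [monomialAt, mem_image, mem_filter] at h
      obtain ⟨t, -, ht⟩ := h
      exact hn t ht
    · apply h
      simp only [monomialAt, Finsupp.finsetSum_apply]
      exact sum_eq_zero fun t _ => Finsupp.single_eq_of_ne (fun e => hn t e.symm)
  · intro h
    simp only [mem_map, mem_univ, true_and] at h
    obtain ⟨t, rfl⟩ := h
    rw [SMonomial.support, mem_union, Finsupp.mem_support_iff]
    have h1 := monomialAt_fst_mem α i t
    have h2 := monomialAt_snd_apply α i t
    change i t ∈ (monomialAt α i).1 ∨ (monomialAt α i).2 (i t) ≠ 0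
    rw [h1, h2]
    rcases α.get t with a | a
    · right; exact a.pos.ne'
    · left; rfl

theorem part_monomialAt (α : DottedComposition) (i : Fin α.length ↪o ℕ) (t : Fin α.length) :
    (monomialAt α i).part (i t) = α.get t := by
  rw [SMonomial.part, monomialAt_snd_apply]
  simp only [monomialAt_fst_mem]
  rcases α.get t with a | a <;> simp [DottedPart.isDotted, DottedPart.val]

theorem sort_map_univ {k : ℕ} (i : Fin k ↪o ℕ) :
    (univ.map i.toEmbedding).sort (· ≤ ·) = List.ofFn i := by
  refine ((sort_perm_toList _ _).trans ?_).eq_of_pairwise' (pairwise_sort _ _)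
    (List.pairwise_ofFn.2 fun _ _ h => (i.strictMono h).le)
  rw [List.perm_ext_iff_of_nodup (nodup_toList _) (List.nodup_ofFn.2 i.injective)]
  simp [List.mem_ofFn]

theorem comp_monomialAt (α : DottedComposition) (i : Fin α.length ↪o ℕ) :
    (monomialAt α i).comp = α := by
  rw [SMonomial.comp, support_monomialAt, sort_map_univ, List.map_ofFn]
  conv_rhs => rw [← List.ofFn_get α]
  exact congrArg List.ofFn (funext (part_monomialAt α i))

theorem monomialAt_injective (α : DottedComposition) : Function.Injective (monomialAt α) := by
  intro i j h
  have h' := congrArg (fun u => (SMonomial.support u).sort) h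
  simp only [support_monomialAt, sort_map_univ] at h'
  exact DFunLike.coe_injective (List.ofFn_injective h')

/-- The increasing enumeration of the support of `u` is an index sequence for `u`; it exists because
no part of a dotted composition is a plain `0`. -/
theorem exists_monomialAt (u : SMonomial) : ∃ i, monomialAt u.comp i = u := by
  have hc : u.support.card = u.comp.length := by simp [SMonomial.comp]
  let i := u.support.orderEmbOfFin hc
  have hi : univ.map i.toEmbedding = u.support :=
    map_orderEmbOfFin_univ u.support hc
  have hs : (monomialAt u.comp i).support = u.support := by rw [support_monomialAt, hi]
  have hp : ∀ n ∈ u.support, (monomialAt u.comp i).part n = u.part n := by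
    intro n hn
    rw [← hi] at hn
    simp only [mem_map, mem_univ, true_and] at hn
    obtain ⟨t, rfl⟩ := hn
    change (monomialAt u.comp i).part (i t) = u.part (i t)
    rw [part_monomialAt]
    exact List.getElem_map _
  have key : ∀ n, (n ∈ (monomialAt u.comp i).1 ↔ n ∈ u.1) ∧ (monomialAt u.comp i).2 n = u.2 n := by
    intro n
    generalize monomialAt u.comp i = v at hs hp
    by_cases hn : n ∈ u.support
    · have h := hp n hn
      rw [SMonomial.part, SMonomial.part] at h
      have hv := hn
      rw [← hs] at hv
      simp only [SMonomial.support, mem_union, Finsupp.mem_support_iff] at hn hv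
      split_ifs at h with h1 h2 h2
      · simp_all
      · simp only [DottedPart.plain.injEq] at h
        have h3 : 0 < v.2 n := Nat.pos_of_ne_zero (hv.resolve_left h1)
        have h4 : 0 < u.2 n := Nat.pos_of_ne_zero (hn.resolve_left h2)
        refine ⟨by simp [h1, h2], ?_⟩
        have := congrArg PNat.val h
        rwa [Nat.toPNat'_coe, Nat.toPNat'_coe, if_pos h3, if_pos h4] at this
    · have hv := hn
      rw [← hs] at hv
      simp only [SMonomial.support, mem_union, Finsupp.mem_support_iff, not_or, not_not] at hn hv
      simp [hn, hv]
  exact ⟨i, Prod.ext (Finset.ext fun n => (key n).1) (Finsupp.ext fun n => (key n).2)⟩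

open Classical in
theorem monomialQSym_apply (α : DottedComposition) (u : SMonomial) :
    (monomialQSym α).1 u = if u.comp = α then 1 else 0 := by
  change (Nat.card {i : Fin α.length ↪o ℕ // monomialAt α i = u} : ℚ) = _
  split_ifs with h
  · subst h
    obtain ⟨i, hi⟩ := exists_monomialAt u
    have : Nat.card {i : Fin u.comp.length ↪o ℕ // monomialAt u.comp i = u} = 1 := by
      rw [Nat.card_eq_one_iff_unique]
      exact ⟨⟨fun a b => Subtype.ext (monomialAt_injective _ (a.2.trans b.2.symm))⟩, ⟨i, hi⟩⟩
    simp [this]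
  · have : IsEmpty {i : Fin α.length ↪o ℕ // monomialAt α i = u} :=
      ⟨fun ⟨i, hi⟩ => h (by rw [← hi, comp_monomialAt])⟩
    simp

open Classical in
theorem fundamental_apply (α : DottedComposition) (u : SMonomial) :
    (fundamental α).1 u = if Preceq u.comp α then 1 else 0 := by
  have h : (fundamental α).1 = ∑ β ∈ (finite_preceq α).toFinset, (monomialQSym β).1 := by
    rw [fundamental, AddSubmonoidClass.coe_finsetSum]
  rw [h, Finset.sum_apply]
  simp [monomialQSym_apply]

/-! ### The refinement order -/

/-- The relation `δ ≼ α`, read off part by part from the left. -/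
inductive Refines : DottedComposition → DottedComposition → Prop
  | nil : Refines [] []
  | cons (p : DottedPart) {δ α : DottedComposition} : Refines δ α → Refines (p :: δ) (p :: α)
  | merge (a b : ℕ+) {δ α : DottedComposition} :
      Refines δ (.plain b :: α) → Refines (.plain a :: δ) (.plain (a + b) :: α)

theorem Refines.refl : ∀ α, Refines α α
  | [] => .nil
  | p :: α => .cons p (Refines.refl α)

theorem Refines.trans_covers {δ α ε : DottedComposition} (h : Refines δ α) (hc : Covers ε α) :
    Refines δ ε := by
  obtain ⟨l, r, a, b, hα, rfl⟩ := hc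
  induction h generalizing l a with
  | nil => simp at hα
  | @cons p δ α h ih =>
    cases l with
    | nil =>
      simp only [List.nil_append, List.cons_append, List.cons.injEq] at hα ⊢
      obtain ⟨rfl, rfl⟩ := hα
      exact .merge a b h
    | cons q l =>
      simp only [List.cons_append, List.cons.injEq] at hα
      obtain ⟨rfl, rfl⟩ := hα
      exact .cons _ (ih l a rfl)
  | @merge c d δ α h ih =>
    cases l with
    | nil =>
      simp only [List.nil_append, List.cons_append, List.cons.injEq, DottedPart.plain.injEq] at hα
      obtain ⟨rfl, rfl⟩ := hα
      rw [List.nil_append, add_assoc]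
      exact .merge c (d + b) (ih [] d rfl)
    | cons q l =>
      simp only [List.cons_append, List.cons.injEq] at hα
      obtain ⟨rfl, rfl⟩ := hα
      exact .merge c d (ih (.plain d :: l) a rfl)

theorem Preceq.cons (p : DottedPart) {δ α : DottedComposition} (h : Preceq δ α) :
    Preceq (p :: δ) (p :: α) := by
  refine Relation.ReflTransGen.lift (p :: ·) ?_ _ _ h
  rintro _ _ ⟨l, r, a, b, rfl, rfl⟩
  exact ⟨p :: l, r, a, b, rfl, rfl⟩

theorem preceq_iff_refines {δ α : DottedComposition} : Preceq δ α ↔ Refines δ α := by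
  constructor
  · intro h
    induction h with
    | refl => exact .refl δ
    | tail _ h ih => exact ih.trans_covers h
  · intro h
    induction h with
    | nil => exact .refl
    | cons p _ ih => exact ih.cons p
    | @merge a b δ α _ ih => exact (ih.cons (.plain a)).tail ⟨[], α, a, b, rfl, rfl⟩

theorem refines_nil_left {α : DottedComposition} : Refines [] α ↔ α = [] :=
  ⟨fun h => by cases h; rfl, fun h => h ▸ .nil⟩

theorem not_refines_cons_nil {p : DottedPart} {δ : DottedComposition} : ¬ Refines (p :: δ) [] :=
  nofun

theorem refines_dotted_dotted {a b : ℕ} {δ α : DottedComposition} :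
    Refines (.dotted a :: δ) (.dotted b :: α) ↔ a = b ∧ Refines δ α :=
  ⟨fun h => by cases h with | cons _ h => exact ⟨rfl, h⟩, fun ⟨e, h⟩ => e ▸ .cons _ h⟩

theorem not_refines_dotted_plain {a : ℕ} {b : ℕ+} {δ α : DottedComposition} :
    ¬ Refines (.dotted a :: δ) (.plain b :: α) :=
  nofun

theorem not_refines_plain_dotted {a : ℕ+} {b : ℕ} {δ α : DottedComposition} :
    ¬ Refines (.plain a :: δ) (.dotted b :: α) :=
  nofun

theorem refines_plain_plain {a b : ℕ+} {δ α : DottedComposition} :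
    Refines (.plain a :: δ) (.plain b :: α) ↔
      (a = b ∧ Refines δ α) ∨ ∃ c, b = a + c ∧ Refines δ (.plain c :: α) := by
  constructor
  · intro h
    cases h with
    | cons _ h => exact .inl ⟨rfl, h⟩
    | merge _ c h => exact .inr ⟨c, rfl, h⟩
  · rintro (⟨rfl, h⟩ | ⟨c, rfl, h⟩)
    · exact .cons _ h
    · exact .merge _ _ h

theorem refines_plain_one_add {c : ℕ+} {δ α : DottedComposition} :
    Refines (.plain 1 :: δ) (.plain (1 + c) :: α) ↔ Refines δ (.plain c :: α) := by
  rw [refines_plain_plain]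
  constructor
  · rintro (⟨h, -⟩ | ⟨d, h, h'⟩)
    · exact absurd h (PNat.lt_add_right 1 c).ne
    · rwa [add_left_cancel h]
  · exact fun h => .inr ⟨c, rfl, h⟩

theorem refines_plain_one_one {δ α : DottedComposition} :
    Refines (.plain 1 :: δ) (.plain 1 :: α) ↔ Refines δ α := by
  rw [refines_plain_plain]
  refine ⟨?_, fun h => .inl ⟨rfl, h⟩⟩
  rintro (⟨-, h⟩ | ⟨d, h, -⟩)
  · exact h
  · exact absurd h (PNat.lt_add_right 1 d).ne

theorem refines_plain_add_add {a c : ℕ+} {δ α : DottedComposition} :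
    Refines (.plain (1 + a) :: δ) (.plain (1 + c) :: α) ↔
      Refines (.plain a :: δ) (.plain c :: α) := by
  simp only [refines_plain_plain, add_assoc, add_right_inj]

theorem not_refines_plain_add_one {a : ℕ+} {δ α : DottedComposition} :
    ¬ Refines (.plain (1 + a) :: δ) (.plain 1 :: α) := by
  rw [refines_plain_plain]
  rintro (⟨h, -⟩ | ⟨d, h, -⟩)
  · exact (PNat.lt_add_right 1 a).ne' h
  · exact ((PNat.lt_add_right 1 a).trans (PNat.lt_add_right _ d)).ne h

/-! ### The composition of a sequence of blocks -/

theorem gammaBlocks_nil : gammaBlocks [] = [] := rfl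

theorem gammaBlocks_cons_fermionic {F : Finset ℕ} (hF : Fermionic F) (s : List (Finset ℕ)) :
    gammaBlocks (F :: s) = .dotted (F.card - 1) :: gammaBlocks s := by
  have h := List.splitBy_append (r := fun B C : Finset ℕ =>
    decide (¬ Fermionic B ∧ ¬ Fermionic C ∧ Below B C)) (l := [F]) (m := s) (by simp [hF])
  have h1 : [F].splitBy (fun B C : Finset ℕ =>
    decide (¬ Fermionic B ∧ ¬ Fermionic C ∧ Below B C)) = [[F]] := rfl
  rw [List.singleton_append, h1] at h
  rw [gammaBlocks, h]
  simp only [List.singleton_append, List.map_cons, if_pos hF]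
  rfl

theorem gammaBlocks_cons_of_not {B : Finset ℕ} (hB : ¬ Fermionic B) {s : List (Finset ℕ)}
    (hs : ∀ C ∈ s.head?, ¬ (¬ Fermionic C ∧ Below B C)) :
    gammaBlocks (B :: s) = .plain 1 :: gammaBlocks s := by
  have h := List.splitBy_append (r := fun B C : Finset ℕ =>
    decide (¬ Fermionic B ∧ ¬ Fermionic C ∧ Below B C)) (l := [B]) (m := s) (by
      intro x hx y hy
      simp only [List.getLast?_singleton, Option.mem_def, Option.some.injEq] at hx
      subst hx
      rw [decide_eq_false_iff_not]
      exact fun h => hs y hy h.2)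
  have h1 : [B].splitBy (fun B C : Finset ℕ =>
    decide (¬ Fermionic B ∧ ¬ Fermionic C ∧ Below B C)) = [[B]] := rfl
  rw [List.singleton_append, h1] at h
  rw [gammaBlocks, h]
  simp only [List.singleton_append, List.map_cons, if_neg hB]
  rfl

/-- A block that is put before a longer run adds `1` to the first part. -/
theorem gammaBlocks_cons_of_below {B C : Finset ℕ} (hB : ¬ Fermionic B) (hC : ¬ Fermionic C)
    (hBC : Below B C) (s : List (Finset ℕ)) :
    ∃ k t, gammaBlocks (C :: s) = .plain k :: t ∧
      gammaBlocks (B :: C :: s) = .plain (1 + k) :: t := by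
  obtain ⟨g, gs, hg⟩ : ∃ g gs, (C :: s).splitBy (fun B C : Finset ℕ =>
      decide (¬ Fermionic B ∧ ¬ Fermionic C ∧ Below B C)) = g :: gs :=
    List.exists_cons_of_ne_nil (by simp)
  obtain ⟨h1, h2, h3, h4⟩ := List.splitBy_eq_iff.1 hg
  cases g with
  | nil => simp at h2
  | cons C' g =>
    simp only [List.flatten_cons, List.cons_append, List.cons.injEq] at h1
    obtain ⟨rfl, h1⟩ := h1
    have hB' : (B :: C :: s).splitBy (fun B C : Finset ℕ =>
        decide (¬ Fermionic B ∧ ¬ Fermionic C ∧ Below B C)) = (B :: C :: g) :: gs := by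
      refine List.splitBy_eq_iff.2 ⟨by simp [h1], by simpa using h2, ?_, ?_⟩
      · intro m hm
        rcases List.mem_cons.1 hm with rfl | hm
        · refine List.isChain_cons_cons.2 ⟨by simpa using ⟨hB, hC, hBC⟩, h3 _ List.mem_cons_self⟩
        · exact h3 m (List.mem_cons_of_mem _ hm)
      · cases gs with
        | nil => simp
        | cons g' gs =>
          rw [List.isChain_cons_cons] at h4 ⊢
          refine ⟨?_, h4.2⟩
          obtain ⟨ha, hb, h⟩ := h4.1
          exact ⟨by simp, hb, by rwa [List.getLast_cons ha]⟩
    refine ⟨g.length.succPNat, gs.map fun run => match run with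
      | [] => .plain 1
      | B :: rest => if Fermionic B then .dotted (B.card - 1)
          else .plain rest.length.succPNat, ?_, ?_⟩
    · rw [gammaBlocks, hg]
      simp only [List.map_cons, if_neg hC]
    · rw [gammaBlocks, hB']
      simp only [List.map_cons, if_neg hB]
      congr 2
      apply PNat.eq
      simp
      omega

/-! ### Monomials as words -/

/-- A monomial in finitely many consecutive variables, as the word of its exponents: each letter
tells whether `θ` occurs and gives the exponent of `x`. -/
abbrev SWord : Type := List (Bool × ℕ)

/-- The monomial of a word, the first letter of which belongs to the index `m`. -/
noncomputable def SWord.monomial : ℕ → SWord → SMonomial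
  | _, [] => (∅, 0)
  | m, (false, a) :: w =>
      ((SWord.monomial (m + 1) w).1, Finsupp.single m a + (SWord.monomial (m + 1) w).2)
  | m, (true, a) :: w =>
      (insert m (SWord.monomial (m + 1) w).1, Finsupp.single m a + (SWord.monomial (m + 1) w).2)

/-- The dotted composition of a word: the letters without a variable are dropped. -/
def SWord.comp : SWord → DottedComposition
  | [] => []
  | (false, 0) :: w => SWord.comp w
  | (false, a + 1) :: w => .plain a.succPNat :: SWord.comp w
  | (true, a) :: w => .dotted a :: SWord.comp w

theorem SWord.le_of_mem_support (w : SWord) :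
    ∀ m, ∀ t ∈ (SWord.monomial m w).support, m ≤ t := by
  induction w with
  | nil => intro m t ht; simp [SWord.monomial, SMonomial.support] at ht
  | cons p w ih =>
    intro m t ht
    by_contra! hlt
    have h : t ∉ (SWord.monomial (m + 1) w).support := fun h => by
      have := ih (m + 1) t h
      omega
    simp only [SMonomial.support, mem_union, Finsupp.mem_support_iff, not_or, not_not] at h
    obtain ⟨_ | _, a⟩ := p <;>
      simp [SWord.monomial, SMonomial.support, h, hlt.ne] at ht

theorem SWord.lt_of_mem_fst {w : SWord} {m t : ℕ} (ht : t ∈ (SWord.monomial (m + 1) w).1) : m < t :=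
  SWord.le_of_mem_support w (m + 1) t (mem_union_left _ ht)

theorem SWord.notMem_fst (w : SWord) (m : ℕ) : m ∉ (SWord.monomial (m + 1) w).1 :=
  fun h => lt_irrefl m (lt_of_mem_fst h)

theorem SWord.snd_apply_eq_zero (w : SWord) (m : ℕ) : (SWord.monomial (m + 1) w).2 m = 0 := by
  by_contra h
  have := SWord.le_of_mem_support w (m + 1) m (mem_union_right _ (Finsupp.mem_support_iff.2 h))
  omega

theorem SWord.card_monomial_fst (w : SWord) :
    ∀ m, (SWord.monomial m w).1.card = w.countP Prod.fst := by
  induction w with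
  | nil => intro m; simp [SWord.monomial]
  | cons p w ih =>
    intro m
    obtain ⟨_ | _, a⟩ := p
    · simp [SWord.monomial, ih]
    · simp [SWord.monomial, card_insert_of_notMem (SWord.notMem_fst w m), ih]

theorem SWord.comp_monomial (w : SWord) : ∀ m, (SWord.monomial m w).comp = SWord.comp w := by
  induction w with
  | nil => intro m; simp [SWord.monomial, SMonomial.comp, SMonomial.support, SWord.comp]
  | cons p w ih =>
    intro m
    have key : ∀ u : SMonomial, u.support = insert m (SWord.monomial (m + 1) w).support →
        (∀ t, m < t → u.part t = (SWord.monomial (m + 1) w).part t) →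
        u.comp = u.part m :: SWord.comp w := by
      intro u hu hp
      rw [SMonomial.comp, hu, sort_insert, List.map_cons, ← ih (m + 1), SMonomial.comp]
      · congr 1
        refine List.map_congr_left fun t ht => hp t ?_
        exact SWord.le_of_mem_support w (m + 1) t ((mem_sort _).1 ht)
      · intro t ht
        have := SWord.le_of_mem_support w (m + 1) t ht
        omega
      · intro h
        have := SWord.le_of_mem_support w (m + 1) m h
        omega
    obtain ⟨b, a⟩ := p
    have hs : ∀ t, m ≠ t → (Finsupp.single m a + (SWord.monomial (m + 1) w).2) t
        = (SWord.monomial (m + 1) w).2 t := fun t ht => by simp [ht]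
    have hm : (Finsupp.single m a + (SWord.monomial (m + 1) w).2) m = a := by
      simp [SWord.snd_apply_eq_zero w m]
    cases b with
    | true =>
      rw [key]
      · simp [SWord.monomial, SMonomial.part, SWord.comp, SWord.snd_apply_eq_zero w m]
      · ext t
        by_cases h : m = t
        · subst h
          simp [SWord.monomial, SMonomial.support]
        · simp [SWord.monomial, SMonomial.support, Ne.symm h, hs t h]
      · intro t ht
        simp only [SWord.monomial, SMonomial.part, hs t ht.ne, mem_insert, ht.ne', false_or]
    | false =>
      cases a with
      | zero =>
        rw [SWord.comp, ← ih (m + 1)]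
        simp [SWord.monomial]
      | succ a =>
        rw [key]
        · simp only [SWord.monomial, SMonomial.part, SWord.comp, SWord.notMem_fst w m, if_false, hm]
          rfl
        · ext t
          by_cases h : m = t
          · subst h
            simp [SWord.monomial, SMonomial.support]
          · simp [SWord.monomial, SMonomial.support, Ne.symm h]
        · intro t ht
          simp only [SWord.monomial, SMonomial.part, hs t ht.ne]

theorem SWord.exists_monomial_eq (k : ℕ) : ∀ (m : ℕ) (u : SMonomial),
    (∀ t ∈ u.support, m ≤ t ∧ t < m + k) → ∃ w : SWord, SWord.monomial m w = u := by
  induction k with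
  | zero =>
    intro m u hu
    have h : u.support = ∅ := eq_empty_of_forall_notMem fun t ht => by
      have := hu t ht
      omega
    rw [SMonomial.support, union_eq_empty, Finsupp.support_eq_empty] at h
    exact ⟨[], Prod.ext h.1.symm h.2.symm⟩
  | succ k ih =>
    intro m u hu
    obtain ⟨w, hw⟩ := ih (m + 1) (u.1.erase m, u.2.erase m) (by
      intro t ht
      simp only [SMonomial.support, mem_union, mem_erase, Finsupp.support_erase] at ht
      have := hu t (by rw [SMonomial.support, mem_union]; tauto)
      have : t ≠ m := by tauto
      omega)
    by_cases h : m ∈ u.1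
    · refine ⟨(true, u.2 m) :: w, ?_⟩
      simp [SWord.monomial, hw, insert_erase h, Finsupp.single_add_erase]
    · refine ⟨(false, u.2 m) :: w, ?_⟩
      simp [SWord.monomial, hw, erase_eq_of_notMem h, Finsupp.single_add_erase]

theorem SWord.monomial_surjective (u : SMonomial) : ∃ w : SWord, SWord.monomial 0 w = u :=
  exists_monomial_eq (u.support.sup id + 1) 0 u fun t ht =>
    ⟨t.zero_le, by have := le_sup (f := id) ht; simp only [id] at this; omega⟩

/-! ### Products, one variable at a time -/

theorem thetaSign_insert_right {m : ℕ} {A B : Finset ℕ} (hA : ∀ t ∈ A, m < t) (hB : m ∉ B) :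
    thetaSign A (insert m B) = (-1) ^ A.card * thetaSign A B := by
  have h : (A ×ˢ insert m B).filter (fun p => p.2 < p.1) =
      A ×ˢ {m} ∪ (A ×ˢ B).filter (fun p => p.2 < p.1) := by
    ext ⟨x, y⟩
    simp only [mem_filter, mem_product, mem_insert, mem_union, mem_singleton]
    constructor
    · tauto
    · rintro (⟨h1, rfl⟩ | h)
      · exact ⟨⟨h1, .inl rfl⟩, hA x h1⟩
      · tauto
  have hd : Disjoint (A ×ˢ {m}) ((A ×ˢ B).filter (fun p => p.2 < p.1)) := by
    rw [disjoint_left]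
    rintro ⟨x, y⟩ h1 h2
    simp only [mem_filter, mem_product, mem_singleton] at h1 h2
    exact hB (h1.2 ▸ h2.1.2)
  rw [thetaSign, h, card_union_of_disjoint hd, pow_add, card_product, card_singleton, mul_one,
    thetaSign]

theorem thetaSign_insert_left {m : ℕ} {A B : Finset ℕ} (hB : ∀ t ∈ B, m < t) :
    thetaSign (insert m A) B = thetaSign A B := by
  rw [thetaSign, thetaSign]
  congr 2
  ext ⟨x, y⟩
  simp only [mem_filter, mem_product, mem_insert]
  constructor
  · rintro ⟨⟨rfl | h1, h2⟩, h3⟩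
    · exact absurd (hB y h2) h3.not_gt
    · tauto
  · tauto

/-- The splittings of an exponent vector: the exponent of the variable `m` splits independently of
the others. -/
theorem sum_antidiagonal_single_add {m a : ℕ} {e : ℕ →₀ ℕ} (he : e m = 0)
    (F : (ℕ →₀ ℕ) × (ℕ →₀ ℕ) → ℚ) :
    ∑ p ∈ antidiagonal (Finsupp.single m a + e), F p =
      ∑ q ∈ antidiagonal a, ∑ p ∈ antidiagonal e,
        F (Finsupp.single m q.1 + p.1, Finsupp.single m q.2 + p.2) := by
  rw [← sum_product']
  symm
  refine sum_nbij'
    (fun x => (Finsupp.single m x.1.1 + x.2.1, Finsupp.single m x.1.2 + x.2.2))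
    (fun p => ((p.1 m, p.2 m), (p.1.erase m, p.2.erase m))) ?_ ?_ ?_ ?_ ?_
  · rintro ⟨⟨b, c⟩, ⟨p, q⟩⟩ h
    simp only [mem_product, HasAntidiagonal.mem_antidiagonal] at h ⊢
    rw [← h.1, ← h.2, Finsupp.single_add]
    abel
  · rintro ⟨p, q⟩ h
    simp only [mem_product, HasAntidiagonal.mem_antidiagonal] at h ⊢
    refine ⟨?_, ?_⟩
    · rw [← Finsupp.add_apply, h]
      simp [he]
    · rw [← Finsupp.erase_add, h, Finsupp.erase_add, Finsupp.erase_single, zero_add,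
        Finsupp.erase_of_notMem_support (by simpa using he)]
  · rintro ⟨⟨b, c⟩, ⟨p, q⟩⟩ h
    simp only [mem_product, HasAntidiagonal.mem_antidiagonal] at h
    have h0 : p m + q m = 0 := by rw [← Finsupp.add_apply, h.2, he]
    have hp : p m = 0 := by omega
    have hq : q m = 0 := by omega
    simp [hp, hq, Finsupp.erase_add, Finsupp.erase_of_notMem_support]
  · rintro ⟨p, q⟩ h
    simp [Finsupp.single_add_erase]
  · rintro ⟨⟨b, c⟩, ⟨p, q⟩⟩ h
    rfl

/-- The product of series on words. Each letter is distributed among the two factors; a `θ` of the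
second factor passes the `θ`s of the first factor that have larger index. -/
def mulWord : SWord → (SWord → ℚ) → (SWord → ℚ) → ℚ
  | [], f, g => f [] * g []
  | (false, a) :: w, f, g => ∑ q ∈ antidiagonal a,
      mulWord w (fun v => f ((false, q.1) :: v)) (fun v => g ((false, q.2) :: v))
  | (true, a) :: w, f, g => ∑ q ∈ antidiagonal a,
      (mulWord w (fun v => f ((true, q.1) :: v)) (fun v => g ((false, q.2) :: v)) +
        mulWord w (fun v => (-1) ^ v.countP Prod.fst * f ((false, q.1) :: v))
          (fun v => g ((true, q.2) :: v)))

theorem mulCoeff_monomial (w : SWord) : ∀ (m : ℕ) (f g : SMonomial → ℚ),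
    mulCoeff f g (SWord.monomial m w) =
      mulWord w (fun v => f (v.monomial m)) (fun v => g (v.monomial m)) := by
  induction w with
  | nil =>
    intro m f g
    simp [mulCoeff, mulWord, SWord.monomial, thetaSign]
  | cons p w ih =>
    intro m f g
    obtain ⟨b, a⟩ := p
    cases b with
    | false =>
      simp only [mulWord, mulCoeff, SWord.monomial,
        sum_antidiagonal_single_add (SWord.snd_apply_eq_zero w m)]
      rw [sum_comm]
      refine sum_congr rfl fun q _ => ?_
      exact ih (m + 1) (fun u => f (u.1, Finsupp.single m q.1 + u.2))
        (fun u => g (u.1, Finsupp.single m q.2 + u.2))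
    | true =>
      simp only [mulWord, mulCoeff, SWord.monomial,
        sum_antidiagonal_single_add (SWord.snd_apply_eq_zero w m)]
      rw [sum_comm]
      refine sum_congr rfl fun q _ => ?_
      rw [sum_powerset_insert (SWord.notMem_fst w m), add_comm]
      congr 1
      · rw [← ih (m + 1) (fun u => f (insert m u.1, Finsupp.single m q.1 + u.2))
          (fun u => g (u.1, Finsupp.single m q.2 + u.2)), mulCoeff]
        refine sum_congr rfl fun A _ => sum_congr rfl fun p _ => ?_
        rw [insert_sdiff_insert, sdiff_insert_of_notMem (SWord.notMem_fst w m),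
          thetaSign_insert_left fun t ht => SWord.lt_of_mem_fst (mem_sdiff.1 ht).1]
      · simp only [← SWord.card_monomial_fst _ (m + 1)]
        rw [← ih (m + 1) (fun u => (-1) ^ u.1.card * f (u.1, Finsupp.single m q.1 + u.2))
          (fun u => g (insert m u.1, Finsupp.single m q.2 + u.2)), mulCoeff]
        refine sum_congr rfl fun A hA => sum_congr rfl fun p _ => ?_
        have hA' := mem_powerset.1 hA
        rw [insert_sdiff_of_notMem _ fun h => SWord.notMem_fst w m (hA' h),
          thetaSign_insert_right (fun t ht => SWord.lt_of_mem_fst (hA' ht))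
            fun h => SWord.notMem_fst w m (mem_sdiff.1 h).1]
        ring

/-! ### Placing a sequence of blocks on the variables -/

/-- `placeRun k T s a` is `k` of what remains of `s` after removal of its first `a` blocks, if
these form an increasing sequence of non-fermionic blocks, all above `T`; otherwise it is `0`. -/
def placeRun (k : List (Finset ℕ) → ℚ) : Finset ℕ → List (Finset ℕ) → ℕ → ℚ
  | _, s, 0 => k s
  | _, [], _ + 1 => 0
  | T, B :: s, a + 1 => if ¬ Fermionic B ∧ Below T B then placeRun k B s a else 0

/-- The coefficient of the monomial of a word in the fundamental function of a sequence of blocks: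
`1` if the sequence can be cut into consecutive pieces, one for each letter, which are an increasing
sequence of `a` blocks for `(false, a)`, a fermionic block with `a` positive elements for
`(true, a)`; otherwise `0`. -/
def place : SWord → List (Finset ℕ) → ℚ
  | [], [] => 1
  | [], _ :: _ => 0
  | (false, a) :: w, s => placeRun (place w) ∅ s a
  | (true, _) :: _, [] => 0
  | (true, a) :: w, F :: s => if Fermionic F ∧ F.card = a + 1 then place w s else 0

open Classical in
/-- A first part `a + 1` of a composition finer than the descent composition of a sequence is a run
of `a + 1` blocks at its head. The first block of the run is `B`, so that `a` blocks above it are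
left. -/
theorem placeRun_eq {δ : DottedComposition} {k : List (Finset ℕ) → ℚ}
    (hk : ∀ s, k s = if Refines δ (gammaBlocks s) then 1 else 0) (a : ℕ) :
    ∀ (B : Finset ℕ) (s : List (Finset ℕ)), ¬ Fermionic B →
      placeRun k B s a =
        if Refines (.plain a.succPNat :: δ) (gammaBlocks (B :: s)) then 1 else 0 := by
  have hs : ∀ b : ℕ, (b + 1).succPNat = 1 + b.succPNat := fun b => by
    apply PNat.eq
    simp
    omega
  have h0 : (0 : ℕ).succPNat = 1 := rfl
  induction a with
  | zero =>
    intro B s hB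
    rw [placeRun, hk, h0]
    congr 1
    by_cases h : ∀ C ∈ s.head?, ¬ (¬ Fermionic C ∧ Below B C)
    · rw [gammaBlocks_cons_of_not hB h, refines_plain_one_one]
    · push Not at h
      obtain ⟨C, hC, hC1, hC2⟩ := h
      obtain ⟨s, rfl⟩ : ∃ s', s = C :: s' := by
        cases s with
        | nil => simp at hC
        | cons D s => simp at hC; exact ⟨s, by rw [hC]⟩
      obtain ⟨k, t, h1, h2⟩ := gammaBlocks_cons_of_below hB hC1 hC2 s
      rw [h1, h2, refines_plain_one_add]
  | succ a ih =>
    intro B s hB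
    cases s with
    | nil =>
      rw [placeRun, gammaBlocks_cons_of_not hB (by simp), hs, if_neg not_refines_plain_add_one]
    | cons C s =>
      rw [placeRun, hs]
      by_cases h : ¬ Fermionic C ∧ Below B C
      · obtain ⟨k, t, h1, h2⟩ := gammaBlocks_cons_of_below hB h.1 h.2 s
        rw [if_pos h, ih C s h.1, h1, h2, refines_plain_add_add]
      · rw [if_neg h, gammaBlocks_cons_of_not hB (by simpa using h),
          if_neg not_refines_plain_add_one]

open Classical in
theorem place_eq (w : SWord) : ∀ s,
    place w s = if Refines (SWord.comp w) (gammaBlocks s) then 1 else 0 := by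
  induction w with
  | nil =>
    intro s
    rw [SWord.comp]
    simp only [refines_nil_left]
    cases s with
    | nil => simp [place, gammaBlocks_nil]
    | cons B s => simp [place, gammaBlocks]
  | cons p w ih =>
    intro s
    obtain ⟨_ | _, a⟩ := p
    · cases a with
      | zero => rw [place, placeRun, SWord.comp, ih]
      | succ a =>
        rw [SWord.comp]
        cases s with
        | nil => rw [place, placeRun, gammaBlocks_nil, if_neg not_refines_cons_nil]
        | cons B s =>
          rw [place, placeRun]
          by_cases hB : Fermionic B
          · rw [if_neg (by tauto), gammaBlocks_cons_fermionic hB, if_neg not_refines_plain_dotted]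
          · rw [if_pos ⟨hB, fun b hb => absurd hb (notMem_empty b)⟩, placeRun_eq ih a B s hB]
    · rw [SWord.comp]
      cases s with
      | nil => rw [place, gammaBlocks_nil, if_neg not_refines_cons_nil]
      | cons B s =>
        rw [place]
        by_cases hB : Fermionic B
        · have : 0 < B.card := card_pos.2 ⟨0, hB⟩
          rw [gammaBlocks_cons_fermionic hB, refines_dotted_dotted, ih]
          by_cases h : B.card = a + 1
          · rw [if_pos ⟨hB, h⟩]
            simp [h]
          · rw [if_neg (by tauto), if_neg (by omega)]
        · rw [if_neg (by tauto)]
          by_cases h : ∀ C ∈ s.head?, ¬ (¬ Fermionic C ∧ Below B C)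
          · rw [gammaBlocks_cons_of_not hB h, if_neg not_refines_dotted_plain]
          · push Not at h
            obtain ⟨C, hC, hC1, hC2⟩ := h
            obtain ⟨s, rfl⟩ : ∃ s', s = C :: s' := by
              cases s with
              | nil => simp at hC
              | cons D s => simp at hC; exact ⟨s, by rw [hC]⟩
            obtain ⟨k, t, h1, h2⟩ := gammaBlocks_cons_of_below hB hC1 hC2 s
            rw [h2, if_neg not_refines_dotted_plain]

theorem fundamental_gammaBlocks_apply (w : SWord) (s : List (Finset ℕ)) :
    (fundamental (gammaBlocks s)).1 (SWord.monomial 0 w) = place w s := by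
  rw [fundamental_apply, place_eq, SWord.comp_monomial]
  congr 1
  exact propext preceq_iff_refines

/-! ### Super-shuffles of two sequences of blocks -/

/-- The blocks that come from the first sequence. -/
abbrev lefts (L : List OBlock) : List (Finset ℕ) := L.filterMap Sum.getLeft?

/-- The blocks that come from the second sequence. -/
abbrev rights (L : List OBlock) : List (Finset ℕ) := L.filterMap Sum.getRight?

/-- The super-shuffles of two sequences of blocks, the second of which need not be a shift. -/
def blockSuperShuffles (I J : List (Finset ℕ)) : Set (List (List OBlock)) :=
  {K | lefts K.flatten = I ∧ rights K.flatten = J ∧ ∀ g ∈ K, IsGroup g}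

theorem finite_blockSuperShuffles (I J : List (Finset ℕ)) : (blockSuperShuffles I J).Finite := by
  set N := I.length + J.length
  let S : Set OBlock := Sum.inl '' {B | B ∈ I} ∪ Sum.inr '' {B | B ∈ J}
  have hS : S.Finite := ((List.finite_toSet _).image _).union ((List.finite_toSet _).image _)
  refine (finite_lists (finite_lists hS N) N).subset ?_
  rintro K ⟨hl, hr, hK⟩
  have hN : K.flatten.length = N := by
    rw [length_eq_of_isShuffle]
    exact congrArg₂ _ (congrArg _ hl) (congrArg _ hr)
  obtain ⟨h1, h2⟩ := length_flatten_le K hK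
  refine ⟨by omega, fun g hg => ⟨by have := h2 g hg; omega, fun b hb => ?_⟩⟩
  have hb' : b ∈ K.flatten := List.mem_flatten.2 ⟨g, hg, hb⟩
  rcases b with b | b
  · exact Or.inl ⟨b, hl ▸ List.mem_filterMap.2 ⟨_, hb', rfl⟩, rfl⟩
  · exact Or.inr ⟨b, hr ▸ List.mem_filterMap.2 ⟨_, hb', rfl⟩, rfl⟩

/-- `blockSuperShuffles` as a finite set. -/
noncomputable def superShufflesOf (I J : List (Finset ℕ)) : Finset (List (List OBlock)) :=
  (finite_blockSuperShuffles I J).toFinset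

theorem mem_superShufflesOf {I J : List (Finset ℕ)} {K : List (List OBlock)} :
    K ∈ superShufflesOf I J ↔
      lefts K.flatten = I ∧ rights K.flatten = J ∧ ∀ g ∈ K, IsGroup g :=
  (finite_blockSuperShuffles I J).mem_toFinset

theorem superShuffles_eq (I J : SetSupercomposition) :
    superShuffles I J = superShufflesOf I.blocks (J.blocks.map (shiftBlock I.n)) := by
  ext K
  rw [mem_superShufflesOf, superShuffles, Set.Finite.mem_toFinset]
  exact and_assoc

theorem cons_mem_superShufflesOf {I J : List (Finset ℕ)} {g : List OBlock}
    {K : List (List OBlock)} :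
    g :: K ∈ superShufflesOf I J ↔ IsGroup g ∧ ∃ I' J', lefts g ++ I' = I ∧ rights g ++ J' = J ∧
      K ∈ superShufflesOf I' J' := by
  simp only [mem_superShufflesOf, lefts, rights, List.flatten_cons, List.filterMap_append,
    List.forall_mem_cons]
  constructor
  · rintro ⟨h1, h2, h3, h4⟩
    exact ⟨h3, _, _, h1, h2, rfl, rfl, h4⟩
  · rintro ⟨h3, _, _, h1, h2, rfl, rfl, h4⟩
    exact ⟨h1, h2, h3, h4⟩

/-- Decomposition of a sum over super-shuffles by the first group, when the summand vanishes unless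
the first group belongs to a given family. -/
theorem sum_superShufflesOf {ι : Type*} {I J : List (Finset ℕ)} (S : Finset ι)
    (g : ι → List OBlock) (I' J' : ι → List (Finset ℕ))
    (hg : ∀ i ∈ S, IsGroup (g i) ∧ lefts (g i) ++ I' i = I ∧ rights (g i) ++ J' i = J)
    (hinj : Set.InjOn g S) (f : List (List OBlock) → ℚ)
    (hf : ∀ K ∈ superShufflesOf I J, f K ≠ 0 → ∃ i ∈ S, ∃ K', K = g i :: K') :
    ∑ K ∈ superShufflesOf I J, f K =
      ∑ i ∈ S, ∑ K ∈ superShufflesOf (I' i) (J' i), f (g i :: K) := by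
  rw [sum_sigma']
  symm
  refine sum_of_injOn (fun x => g x.1 :: x.2) ?_ ?_ ?_ fun _ _ => rfl
  · rintro ⟨i, K⟩ hi ⟨j, K'⟩ hj h
    simp only [coe_sigma, Set.mem_sigma_iff, mem_coe, List.cons.injEq] at hi hj h
    obtain rfl := hinj hi.1 hj.1 h.1
    rw [h.2]
  · rintro ⟨i, K⟩ hi
    simp only [coe_sigma, Set.mem_sigma_iff, mem_coe] at hi ⊢
    obtain ⟨h1, h2, h3⟩ := hg i hi.1
    exact cons_mem_superShufflesOf.2 ⟨h1, _, _, h2, h3, hi.2⟩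
  · intro K hK hn
    by_contra h
    obtain ⟨i, hi, K', rfl⟩ := hf K hK h
    obtain ⟨_, I'', J'', h2, h3, hK'⟩ := cons_mem_superShufflesOf.1 hK
    obtain ⟨_, h4, h5⟩ := hg i hi
    rw [List.append_cancel_left (h2.trans h4.symm), List.append_cancel_left (h3.trans h5.symm)]
      at hK'
    exact hn ⟨⟨i, K'⟩, by simpa using ⟨hi, hK'⟩, rfl⟩

/-! ### Groups, their unions and their signs -/

/-- The union of the blocks of a group. -/
def groupSet (g : List OBlock) : Finset ℕ := (g.map OBlock.set).foldr (· ∪ ·) ∅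

theorem superShuffleBlocks_cons (g : List OBlock) (K : List (List OBlock)) :
    superShuffleBlocks (g :: K) = groupSet g :: superShuffleBlocks K := rfl

theorem groupSet_singleton (b : OBlock) : groupSet [b] = b.set := by
  simp [groupSet]

theorem groupSet_inl_cons (F : Finset ℕ) (s : List (Finset ℕ)) :
    groupSet (Sum.inl F :: s.map Sum.inr) = F ∪ s.foldr (· ∪ ·) ∅ := by
  simp only [groupSet, List.map_cons, List.foldr_cons, List.map_map]
  congr 2
  exact List.map_id s

theorem groupSet_append_inr (F : Finset ℕ) (s : List (Finset ℕ)) :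
    groupSet (s.map Sum.inl ++ [Sum.inr F]) = F ∪ s.foldr (· ∪ ·) ∅ := by
  induction s with
  | nil => simp [groupSet, OBlock.set]
  | cons B s ih =>
    rw [List.foldr_cons, union_left_comm, ← ih]
    rfl

theorem mem_foldr_union {s : List (Finset ℕ)} {x : ℕ} :
    x ∈ s.foldr (· ∪ ·) ∅ ↔ ∃ B ∈ s, x ∈ B := by
  induction s with
  | nil => simp
  | cons B s ih => simp [ih]

theorem IncreasingSeq.card_foldr_union {s : List (Finset ℕ)} (hs : IncreasingSeq s)
    (hc : ∀ B ∈ s, ¬ Fermionic B → B.card = 1) : (s.foldr (· ∪ ·) ∅).card = s.length := by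
  obtain ⟨hf, hs⟩ := hs
  -- By transitivity through nonempty blocks, every block lies below all the later ones.
  suffices h : (s.foldr (· ∪ ·) ∅).card = s.length ∧
      ∀ B ∈ s.head?, ∀ x ∈ s.tail.foldr (· ∪ ·) ∅, ∀ b ∈ B, b < x from h.1
  induction s with
  | nil => simp
  | cons B s ih =>
    obtain ⟨h1, h2⟩ := ih (fun C hC => hc C (List.mem_cons_of_mem _ hC))
      (fun C hC => hf C (List.mem_cons_of_mem _ hC)) hs.tail
    have h3 : ∀ x ∈ s.foldr (· ∪ ·) ∅, ∀ b ∈ B, b < x := by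
      cases s with
      | nil => simp
      | cons C s =>
        intro x hx b hb
        have hBC := (List.isChain_cons_cons.1 hs).1
        rw [List.foldr_cons, mem_union] at hx
        rcases hx with hx | hx
        · exact hBC b hb x hx
        · have hC : 0 < C.card := by
            rw [hc C (by simp) (hf C (by simp))]
            exact one_pos
          obtain ⟨c, hc⟩ := card_pos.1 hC
          exact (hBC b hb c hc).trans (h2 C rfl x hx c hc)
    refine ⟨?_, by simpa using fun x hx => h3 x hx⟩
    rw [List.foldr_cons, card_union_of_disjoint, h1, hc B (by simp) (hf B (by simp)),
      List.length_cons, add_comm]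
    rw [disjoint_left]
    exact fun x hx hx' => lt_irrefl x (h3 x hx' x hx)

theorem card_union_foldr {F : Finset ℕ} {s : List (Finset ℕ)} (hs : IncreasingSeq s)
    (hc : ∀ B ∈ s, ¬ Fermionic B → B.card = 1) (hd : ∀ B ∈ s, F ∩ B ⊆ {0}) :
    (F ∪ s.foldr (· ∪ ·) ∅).card = F.card + s.length := by
  rw [card_union_of_disjoint, hs.card_foldr_union hc]
  rw [disjoint_left]
  intro x hx hx'
  obtain ⟨B, hB, hxB⟩ := mem_foldr_union.1 hx'
  have h0 := hd B hB (mem_inter.2 ⟨hx, hxB⟩)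
  rw [mem_singleton] at h0
  subst h0
  exact hs.1 B hB hxB

theorem increasingSeq_nil : IncreasingSeq [] := ⟨by simp, by simp⟩

/-- The groups sorted by the kind of their union. -/
theorem isGroup_iff {g : List OBlock} : IsGroup g ↔
    (∃ B, ¬ Fermionic B ∧ (g = [Sum.inl B] ∨ g = [Sum.inr B])) ∨
    (∃ F s, Fermionic F ∧ IncreasingSeq s ∧ g = Sum.inl F :: s.map Sum.inr) ∨
    (∃ F s, Fermionic F ∧ IncreasingSeq s ∧ g = s.map Sum.inl ++ [Sum.inr F]) := by
  constructor
  · rintro (⟨b | b, rfl⟩ | h | h)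
    · by_cases hb : Fermionic b
      · exact .inr (.inl ⟨b, [], hb, increasingSeq_nil, rfl⟩)
      · exact .inl ⟨b, hb, .inl rfl⟩
    · by_cases hb : Fermionic b
      · exact .inr (.inr ⟨b, [], hb, increasingSeq_nil, rfl⟩)
      · exact .inl ⟨b, hb, .inr rfl⟩
    · exact .inr (.inl h)
    · exact .inr (.inr h)
  · rintro (⟨B, _, rfl | rfl⟩ | h | h)
    · exact .inl ⟨_, rfl⟩
    · exact .inl ⟨_, rfl⟩
    · exact .inr (.inl h)
    · exact .inr (.inr h)

theorem lefts_map_inl (s : List (Finset ℕ)) : lefts (s.map Sum.inl) = s := by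
  induction s with
  | nil => rfl
  | cons B s ih => simpa [lefts] using ih

theorem lefts_map_inr (s : List (Finset ℕ)) : lefts (s.map Sum.inr) = [] := by
  simp [lefts]

theorem rights_map_inr (s : List (Finset ℕ)) : rights (s.map Sum.inr) = s := by
  induction s with
  | nil => rfl
  | cons B s ih => simpa [rights] using ih

theorem rights_map_inl (s : List (Finset ℕ)) : rights (s.map Sum.inl) = [] := by
  simp [rights]

theorem lefts_map_append_map (s t : List (Finset ℕ)) :
    lefts (s.map Sum.inl ++ t.map Sum.inr) = s := by
  rw [lefts, List.filterMap_append]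
  exact (congrArg₂ _ (lefts_map_inl s) (lefts_map_inr t)).trans s.append_nil

theorem rights_map_append_map (s t : List (Finset ℕ)) :
    rights (s.map Sum.inl ++ t.map Sum.inr) = t := by
  rw [rights, List.filterMap_append]
  exact congrArg₂ _ (rights_map_inl s) (rights_map_inr t)

theorem inversions_map_inl_append (s : List (Finset ℕ)) (L : List OBlock) :
    inversions (s.map Sum.inl ++ L) = inversions L := by
  induction s with
  | nil => rfl
  | cons B s ih => exact ih

theorem inversions_map_inr_append {s : List (Finset ℕ)} (hs : ∀ B ∈ s, ¬ Fermionic B)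
    (L : List OBlock) : inversions (s.map Sum.inr ++ L) = inversions L := by
  induction s with
  | nil => rfl
  | cons B s ih =>
    rw [List.map_cons, List.cons_append, inversions, if_neg (hs B (by simp)), zero_add]
    exact ih fun C hC => hs C (List.mem_cons_of_mem _ hC)

/-! ### Runs of non-fermionic blocks -/

theorem mulWord_zero_left (w : SWord) : ∀ g, mulWord w (fun _ => 0) g = 0 := by
  induction w with
  | nil => intro g; simp [mulWord]
  | cons p w ih => intro g; obtain ⟨_ | _, a⟩ := p <;> simp [mulWord, ih]

theorem mulWord_zero_right (w : SWord) : ∀ f, mulWord w f (fun _ => 0) = 0 := by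
  induction w with
  | nil => intro f; simp [mulWord]
  | cons p w ih => intro f; obtain ⟨_ | _, a⟩ := p <;> simp [mulWord, ih]

theorem mulWord_const_mul_left (c : ℚ) (w : SWord) :
    ∀ f g, mulWord w (fun v => c * f v) g = c * mulWord w f g := by
  induction w with
  | nil => intro f g; simp [mulWord, mul_assoc]
  | cons p w ih =>
    intro f g
    obtain ⟨_ | _, a⟩ := p
    · simp only [mulWord, ih, mul_sum]
    · simp only [mulWord, mul_left_comm _ c, ih, mul_sum, mul_add]

theorem sum_antidiagonal_succ_of_eq_add {a : ℕ} (F U V : ℕ → ℕ → ℚ)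
    (h1 : ∀ b, F (b + 1) 0 = U b 0) (h2 : ∀ c, F 0 (c + 1) = V 0 c)
    (h3 : ∀ b c, F (b + 1) (c + 1) = U b (c + 1) + V (b + 1) c) :
    ∑ q ∈ antidiagonal (a + 1), F q.1 q.2 =
      ∑ q ∈ antidiagonal a, U q.1 q.2 + ∑ q ∈ antidiagonal a, V q.1 q.2 := by
  let U' : ℕ → ℕ → ℚ := fun b c => match b with
    | 0 => 0
    | b + 1 => U b c
  let V' : ℕ → ℕ → ℚ := fun b c => match c with
    | 0 => 0
    | c + 1 => V b c
  have hU : ∑ q ∈ antidiagonal (a + 1), U' q.1 q.2 = ∑ q ∈ antidiagonal a, U q.1 q.2 := by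
    rw [Nat.sum_antidiagonal_succ]
    simp [U']
  have hV : ∑ q ∈ antidiagonal (a + 1), V' q.1 q.2 = ∑ q ∈ antidiagonal a, V q.1 q.2 := by
    rw [Nat.sum_antidiagonal_succ']
    simp [V']
  rw [← hU, ← hV, ← sum_add_distrib]
  refine sum_congr rfl fun q hq => ?_
  obtain ⟨b, c⟩ := q
  rw [HasAntidiagonal.mem_antidiagonal] at hq
  cases b with
  | zero =>
    cases c with
    | zero => simp at hq
    | succ c => simp [U', V', h2]
  | succ b =>
    cases c with
    | zero => simp [U', V', h1]
    | succ c => simp [U', V', h3]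

/-- What the product rule requires of the two sequences: their non-fermionic blocks are singletons,
and a block of the one shares at most the element `0` with a block of the other. -/
structure Compatible (I J : List (Finset ℕ)) : Prop where
  left : ∀ B ∈ I, ¬ Fermionic B → B.card = 1
  right : ∀ C ∈ J, ¬ Fermionic C → C.card = 1
  inter : ∀ B ∈ I, ∀ C ∈ J, B ∩ C ⊆ {0}

theorem Compatible.mono {I J I' J' : List (Finset ℕ)} (h : Compatible I J) (hI : I' ⊆ I)
    (hJ : J' ⊆ J) : Compatible I' J' :=
  ⟨fun B hB => h.left B (hI hB), fun C hC => h.right C (hJ hC),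
    fun B hB C hC => h.inter B (hI hB) C (hJ hC)⟩

theorem below_of_not_below {B C : Finset ℕ} (hB : B.card = 1) (hC : C.card = 1)
    (h : B ∩ C ⊆ {0}) (hB0 : ¬ Fermionic B) (hn : ¬ Below B C) : Below C B := by
  obtain ⟨b, rfl⟩ := card_eq_one.1 hB
  obtain ⟨c, rfl⟩ := card_eq_one.1 hC
  simp only [Below, mem_singleton, forall_eq] at hn ⊢
  have hne : b ≠ c := by
    rintro rfl
    rw [inter_self, singleton_subset_singleton] at h
    exact hB0 (by simp [h])
  omega

theorem not_below_of_below {B C : Finset ℕ} (hB : B.card = 1) (hC : C.card = 1)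
    (h : Below B C) : ¬ Below C B := by
  obtain ⟨b, rfl⟩ := card_eq_one.1 hB
  obtain ⟨c, rfl⟩ := card_eq_one.1 hC
  simp only [Below, mem_singleton, forall_eq] at h ⊢
  omega

theorem Below.trans_of_card {A B C : Finset ℕ} (hB : B.card = 1) (h : Below A B)
    (h' : Below B C) : Below A C := by
  obtain ⟨b, rfl⟩ := card_eq_one.1 hB
  intro a ha c hc
  exact (h a ha b (mem_singleton_self b)).trans (h' b (mem_singleton_self b) c hc)

/-- The coefficients of the products in which the two factors contribute runs above `T`, of total
length `a`, to the variable before the word `w`. -/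
def mulRun (w : SWord) (T : Finset ℕ) (I J : List (Finset ℕ)) (a : ℕ) : ℚ :=
  ∑ q ∈ antidiagonal a,
    mulWord w (fun v => placeRun (place v) T I q.1) (fun v => placeRun (place v) T J q.2)

/-- The signed sum over the super-shuffles that contribute a run above `T`, of length `a`, to the
variable before the word `w`. -/
noncomputable def shuffleRun (w : SWord) (T : Finset ℕ) (I J : List (Finset ℕ)) (a : ℕ) : ℚ :=
  ∑ K ∈ superShufflesOf I J,
    superShuffleSign K * placeRun (place w) T (superShuffleBlocks K) a

/-- The smallest block of the two runs is the first block of the one or of the other. -/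
theorem mulRun_succ (w : SWord) (T : Finset ℕ) {I J : List (Finset ℕ)} (h : Compatible I J)
    (a : ℕ) : mulRun w T I J (a + 1) =
      (∑ B ∈ I.head?.toFinset,
        if ¬ Fermionic B ∧ Below T B then mulRun w B I.tail J a else 0) +
      ∑ C ∈ J.head?.toFinset,
        if ¬ Fermionic C ∧ Below T C then mulRun w C I J.tail a else 0 := by
  have hU : ∀ S : Finset (Finset ℕ), ∀ X : Finset ℕ → List (Finset ℕ) × List (Finset ℕ),
      (∑ B ∈ S, if ¬ Fermionic B ∧ Below T B then mulRun w B (X B).1 (X B).2 a else 0) =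
      ∑ q ∈ antidiagonal a, ∑ B ∈ S, if ¬ Fermionic B ∧ Below T B then
        mulWord w (fun v => placeRun (place v) B (X B).1 q.1)
          (fun v => placeRun (place v) B (X B).2 q.2) else 0 := by
    intro S X
    rw [sum_comm]
    refine sum_congr rfl fun B _ => ?_
    split_ifs
    · rfl
    · simp
  rw [hU _ fun _ => (I.tail, J), hU _ fun _ => (I, J.tail)]
  refine sum_antidiagonal_succ_of_eq_add
    (fun b c => mulWord w (fun v => placeRun (place v) T I b) (fun v => placeRun (place v) T J c))
    (fun b c => ∑ B ∈ I.head?.toFinset, if ¬ Fermionic B ∧ Below T B then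
        mulWord w (fun v => placeRun (place v) B I.tail b) (fun v => placeRun (place v) B J c)
        else 0)
    (fun b c => ∑ C ∈ J.head?.toFinset, if ¬ Fermionic C ∧ Below T C then
        mulWord w (fun v => placeRun (place v) C I b) (fun v => placeRun (place v) C J.tail c)
        else 0) ?_ ?_ ?_
  · intro b
    cases I with
    | nil => simp [placeRun, mulWord_zero_left]
    | cons B I =>
      simp only [List.head?_cons, Option.toFinset_some, sum_singleton, List.tail_cons, placeRun]
      split_ifs
      · rfl
      · exact mulWord_zero_left w _
  · intro c
    cases J with
    | nil => simp [placeRun, mulWord_zero_right]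
    | cons C J =>
      simp only [List.head?_cons, Option.toFinset_some, sum_singleton, List.tail_cons, placeRun]
      split_ifs
      · rfl
      · exact mulWord_zero_right w _
  · intro b c
    cases I with
    | nil => simp [placeRun, mulWord_zero_left]
    | cons B I =>
      cases J with
      | nil => simp [placeRun, mulWord_zero_right]
      | cons C J =>
        simp only [List.head?_cons, Option.toFinset_some, sum_singleton, List.tail_cons, placeRun]
        by_cases hB : ¬ Fermionic B ∧ Below T B
        · have hB1 := h.left B (by simp) hB.1
          by_cases hC : ¬ Fermionic C ∧ Below T C
          · have hC1 := h.right C (by simp) hC.1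
            -- Exactly one of `B`, `C` lies below the other, so exactly one summand survives.
            by_cases hBC : Below B C
            · simp only [if_pos hB, if_pos hC, if_pos (And.intro hC.1 hBC),
                if_neg fun h' : ¬ Fermionic B ∧ Below C B => not_below_of_below hB1 hC1 hBC h'.2,
                mulWord_zero_left, add_zero]
            · have hCB := below_of_not_below hB1 hC1 (h.inter B (by simp) C (by simp)) hB.1 hBC
              simp only [if_pos hB, if_pos hC, if_pos (And.intro hB.1 hCB),
                if_neg fun h' : ¬ Fermionic C ∧ Below B C => hBC h'.2,
                mulWord_zero_right, zero_add]
          · simp only [if_pos hB, if_neg hC, if_neg fun h' : ¬ Fermionic C ∧ Below B C =>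
              hC ⟨h'.1, hB.2.trans_of_card hB1 h'.2⟩, mulWord_zero_right, zero_add]
        · by_cases hC : ¬ Fermionic C ∧ Below T C
          · have hC1 := h.right C (by simp) hC.1
            simp only [if_pos hC, if_neg hB, if_neg fun h' : ¬ Fermionic B ∧ Below C B =>
              hB ⟨h'.1, hC.2.trans_of_card hC1 h'.2⟩, mulWord_zero_left, zero_add]
          · simp only [if_neg hB, if_neg hC, mulWord_zero_left, zero_add]

/-- A run of a super-shuffle starts with the first block of the one sequence or of the other. -/
theorem shuffleRun_succ (w : SWord) (T : Finset ℕ) (I J : List (Finset ℕ)) (a : ℕ) :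
    shuffleRun w T I J (a + 1) =
      (∑ B ∈ I.head?.toFinset,
        if ¬ Fermionic B ∧ Below T B then shuffleRun w B I.tail J a else 0) +
      ∑ C ∈ J.head?.toFinset,
        if ¬ Fermionic C ∧ Below T C then shuffleRun w C I J.tail a else 0 := by
  have hhead : ∀ {s : List (Finset ℕ)} {B : Finset ℕ}, B ∈ s.head?.toFinset →
      [B] ++ s.tail = s := by
    intro s B hB
    cases s with
    | nil => simp at hB
    | cons C s => simp at hB; simp [hB]
  rw [shuffleRun, sum_superShufflesOf (I.head?.toFinset.disjSum J.head?.toFinset) (fun b => [b])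
    (Sum.elim (fun _ => I.tail) fun _ => I) (Sum.elim (fun _ => J) fun _ => J.tail), sum_disjSum]
  · congr 1
    · refine sum_congr rfl fun B _ => ?_
      simp only [superShuffleBlocks_cons, groupSet_singleton, placeRun, OBlock.set, Sum.elim_inl,
        id]
      split_ifs with h
      · refine sum_congr rfl fun K _ => ?_
        rfl
      · simp
    · refine sum_congr rfl fun C _ => ?_
      simp only [superShuffleBlocks_cons, groupSet_singleton, placeRun, OBlock.set, Sum.elim_inr,
        id]
      split_ifs with h
      · refine sum_congr rfl fun K _ => ?_
        congr 1
        simp [superShuffleSign, inversions, h.1]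
      · simp
  · rintro (B | C) h
    · exact ⟨.inl ⟨_, rfl⟩, hhead (inl_mem_disjSum.1 h), rfl⟩
    · exact ⟨.inl ⟨_, rfl⟩, rfl, hhead (inr_mem_disjSum.1 h)⟩
  · intro b _ c _ h
    simpa using h
  · intro K hK hne
    cases K with
    | nil => simp [superShuffleBlocks, placeRun] at hne
    | cons g K =>
      rw [superShuffleBlocks_cons, placeRun] at hne
      have hg : ¬ Fermionic (groupSet g) := by
        intro h
        simp [h] at hne
      obtain ⟨h1, I', J', rfl, rfl, _⟩ := cons_mem_superShufflesOf.1 hK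
      rcases isGroup_iff.1 h1 with ⟨B, _, rfl | rfl⟩ | ⟨F, s, hF, _, rfl⟩ | ⟨F, s, hF, _, rfl⟩
      · exact ⟨Sum.inl B, by simp, K, rfl⟩
      · exact ⟨Sum.inr B, by simp, K, rfl⟩
      · rw [groupSet_inl_cons] at hg
        exact absurd (mem_union_left _ hF) hg
      · rw [groupSet_append_inr] at hg
        exact absurd (mem_union_left _ hF) hg

theorem mulRun_eq_shuffleRun {w : SWord}
    (hw : ∀ I J, Compatible I J → mulWord w (fun v => place v I) (fun v => place v J) =
      ∑ K ∈ superShufflesOf I J, superShuffleSign K * place w (superShuffleBlocks K)) (a : ℕ) :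
    ∀ (T : Finset ℕ) (I J : List (Finset ℕ)), Compatible I J →
      mulRun w T I J a = shuffleRun w T I J a := by
  induction a with
  | zero =>
    intro T I J h
    simpa [mulRun, shuffleRun, placeRun] using hw I J h
  | succ a ih =>
    intro T I J h
    rw [mulRun_succ w T h, shuffleRun_succ]
    simp only [ih _ _ _ (h.mono I.tail_subset (List.Subset.refl J)),
      ih _ _ _ (h.mono (List.Subset.refl I) J.tail_subset)]

/-! ### Fermionic blocks -/

theorem placeRun_eq_ite_isChain (k : List (Finset ℕ) → ℚ) [DecidablePred IncreasingSeq] (a : ℕ) :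
    ∀ (T : Finset ℕ) (s : List (Finset ℕ)), placeRun k T s a =
      if a ≤ s.length ∧ IncreasingSeq (s.take a) ∧ ∀ B ∈ (s.take a).head?, Below T B
        then k (s.drop a) else 0 := by
  induction a with
  | zero => intro T s; simp [placeRun, increasingSeq_nil]
  | succ a ih =>
    intro T s
    cases s with
    | nil => simp [placeRun]
    | cons B s =>
      have key : (¬ Fermionic B ∧ Below T B) ∧ (a ≤ s.length ∧ IncreasingSeq (s.take a) ∧
          ∀ C ∈ (s.take a).head?, Below B C) ↔
          (a + 1 ≤ (B :: s).length ∧ IncreasingSeq ((B :: s).take (a + 1)) ∧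
            ∀ C ∈ ((B :: s).take (a + 1)).head?, Below T C) := by
        simp only [IncreasingSeq, List.take_succ_cons, List.isChain_cons, List.head?_cons,
          List.forall_mem_cons, Option.mem_def, Option.some.injEq, forall_eq', List.length_cons,
          Nat.add_le_add_iff_right]
        tauto
      rw [placeRun, ih, List.drop_succ_cons, ← ite_and]
      exact if_congr key rfl rfl

theorem placeRun_empty (k : List (Finset ℕ) → ℚ) [DecidablePred IncreasingSeq] (s : List (Finset ℕ))
    (a : ℕ) : placeRun k ∅ s a =
      if a ≤ s.length ∧ IncreasingSeq (s.take a) then k (s.drop a) else 0 := by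
  rw [placeRun_eq_ite_isChain]
  refine if_congr ⟨fun h => ⟨h.1, h.2.1⟩, fun h => ⟨h.1, h.2, ?_⟩⟩ rfl rfl
  exact fun B _ b hb => absurd hb (notMem_empty b)

theorem countP_drop_of_increasingSeq {s : List (Finset ℕ)} {a : ℕ} (h : IncreasingSeq (s.take a)) :
    (s.drop a).countP (fun B => decide (Fermionic B)) =
      s.countP fun B => decide (Fermionic B) := by
  conv_rhs => rw [← List.take_append_drop a s, List.countP_append]
  rw [List.countP_eq_zero (l := s.take a) |>.2 fun B hB => by simpa using h.1 B hB, zero_add]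

/-- A sequence of blocks can be placed on those words only that have as many `θ`s as the sequence
has fermionic blocks. -/
theorem neg_one_pow_mul_place (w : SWord) : ∀ s, (-1) ^ w.countP Prod.fst * place w s =
    (-1) ^ s.countP (fun B => decide (Fermionic B)) * place w s := by
  classical
  induction w with
  | nil => intro s; cases s <;> simp [place]
  | cons p w ih =>
    intro s
    obtain ⟨_ | _, a⟩ := p
    · rw [place, placeRun_empty]
      split_ifs with h
      · rw [← countP_drop_of_increasingSeq h.2]
        simpa using ih _
      · simp
    · cases s with
      | nil => simp [place]
      | cons F s =>
        rw [place]
        split_ifs with h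
        · simp [h.1, pow_succ, ih]
        · simp

/-- The condition that the first block of `I`, fermionic with `q.1` positive elements, and the first
`q.2` blocks of `J` can be united to a group. -/
def IsHeadGroup (I J : List (Finset ℕ)) (q : ℕ × ℕ) : Prop :=
  (∃ F ∈ I.head?, Fermionic F ∧ F.card = q.1 + 1) ∧ q.2 ≤ J.length ∧ IncreasingSeq (J.take q.2)

theorem IsHeadGroup.exists_cons {I J : List (Finset ℕ)} {q : ℕ × ℕ} (h : IsHeadGroup I J q) :
    ∃ F I', I = F :: I' ∧ Fermionic F ∧ F.card = q.1 + 1 := by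
  obtain ⟨⟨F, hF, h⟩, -⟩ := h
  cases I with
  | nil => simp at hF
  | cons B I =>
    simp only [List.head?_cons, Option.mem_def, Option.some.injEq] at hF
    exact ⟨F, I, by rw [hF], h⟩

theorem isHeadGroup_cons_append {F : Finset ℕ} (hF : Fermionic F) {s : List (Finset ℕ)}
    (hs : IncreasingSeq s) (I J : List (Finset ℕ)) :
    IsHeadGroup (F :: I) (s ++ J) (F.card - 1, s.length) := by
  have : 0 < F.card := card_pos.2 ⟨0, hF⟩
  exact ⟨⟨F, rfl, hF, by simp only; omega⟩, by simp, by simpa using hs⟩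

/-- A `θ` of the first factor: a fermionic block of `I` meets a run of `J`. -/
theorem mulWord_theta_left [DecidablePred IncreasingSeq] (w : SWord) (I J : List (Finset ℕ))
    (q : ℕ × ℕ) [Decidable (IsHeadGroup I J q)] :
    mulWord w (fun v => place ((true, q.1) :: v) I) (fun v => placeRun (place v) ∅ J q.2) =
      if IsHeadGroup I J q then
        mulWord w (fun v => place v I.tail) (fun v => place v (J.drop q.2)) else 0 := by
  simp only [placeRun_empty]
  cases I with
  | nil => simp [place, mulWord_zero_left, IsHeadGroup]
  | cons F I =>
    simp only [place, IsHeadGroup, List.head?_cons, Option.mem_def, Option.some.injEq,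
      exists_eq_left', List.tail_cons]
    by_cases h1 : Fermionic F ∧ F.card = q.1 + 1
    · by_cases h2 : q.2 ≤ J.length ∧ IncreasingSeq (J.take q.2)
      · simp only [if_pos h1, if_pos h2, if_pos (And.intro h1 h2)]
      · simp only [if_neg h2, if_neg (fun h => h2 (And.right h)), mulWord_zero_right]
    · simp only [if_neg h1, if_neg (fun h => h1 (And.left h)), mulWord_zero_left]

/-- A `θ` of the second factor: a run of `I` meets a fermionic block of `J`. -/
theorem mulWord_theta_right [DecidablePred IncreasingSeq] (w : SWord) (I J : List (Finset ℕ))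
    (q : ℕ × ℕ) [Decidable (IsHeadGroup J I q.swap)] :
    mulWord w (fun v => (-1) ^ v.countP Prod.fst * placeRun (place v) ∅ I q.1)
        (fun v => place ((true, q.2) :: v) J) =
      if IsHeadGroup J I q.swap then
        (-1) ^ (I.drop q.1).countP (fun B => decide (Fermionic B)) *
          mulWord w (fun v => place v (I.drop q.1)) (fun v => place v J.tail) else 0 := by
  simp only [placeRun_empty, mul_ite, mul_zero, neg_one_pow_mul_place]
  cases J with
  | nil => simp [place, mulWord_zero_right, IsHeadGroup]
  | cons F J =>
    simp only [place, IsHeadGroup, List.head?_cons, Option.mem_def, Option.some.injEq,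
      exists_eq_left', List.tail_cons, Prod.fst_swap, Prod.snd_swap]
    by_cases h1 : Fermionic F ∧ F.card = q.2 + 1
    · by_cases h2 : q.1 ≤ I.length ∧ IncreasingSeq (I.take q.1)
      · simp only [if_pos h1, if_pos h2, if_pos (And.intro h1 h2), mulWord_const_mul_left]
      · simp only [if_neg h2, if_neg (fun h => h2 (And.right h)), mulWord_zero_left]
    · simp only [if_neg h1, if_neg (fun h => h1 (And.left h)), mulWord_zero_right]

/-- The first group of a super-shuffle that meets a `θ`: a fermionic block of `I` followed by
`q.2` blocks of `J` for `Sum.inl q`, or `q.1` blocks of `I` followed by a fermionic block of `J`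
for `Sum.inr q`. -/
def headGroup (I J : List (Finset ℕ)) : (ℕ × ℕ) ⊕ (ℕ × ℕ) → List OBlock :=
  Sum.elim (fun q => (I.take 1).map Sum.inl ++ (J.take q.2).map Sum.inr)
    (fun q => (I.take q.1).map Sum.inl ++ (J.take 1).map Sum.inr)

theorem headGroup_inl (F : Finset ℕ) (I J : List (Finset ℕ)) (q : ℕ × ℕ) :
    headGroup (F :: I) J (.inl q) = Sum.inl F :: (J.take q.2).map Sum.inr := by
  simp [headGroup]

theorem headGroup_inr (F : Finset ℕ) (I J : List (Finset ℕ)) (q : ℕ × ℕ) :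
    headGroup I (F :: J) (.inr q) = (I.take q.1).map Sum.inl ++ [Sum.inr F] := by
  simp [headGroup]

theorem isGroup_headGroup_inl {I J : List (Finset ℕ)} {q : ℕ × ℕ} (h : IsHeadGroup I J q) :
    IsGroup (headGroup I J (.inl q)) := by
  obtain ⟨F, I, rfl, hF, _⟩ := h.exists_cons
  exact .inr (.inl ⟨F, _, hF, h.2.2, headGroup_inl F I J q⟩)

theorem isGroup_headGroup_inr {I J : List (Finset ℕ)} {q : ℕ × ℕ} (h : IsHeadGroup J I q.swap) :
    IsGroup (headGroup I J (.inr q)) := by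
  obtain ⟨F, J, rfl, hF, _⟩ := h.exists_cons
  exact .inr (.inr ⟨F, _, hF, h.2.2, headGroup_inr F I J q⟩)

theorem headGroup_inl_ne_inr {I J : List (Finset ℕ)} {q r : ℕ × ℕ} (h : IsHeadGroup I J q)
    (h' : IsHeadGroup J I r.swap) : headGroup I J (.inl q) ≠ headGroup I J (.inr r) := by
  obtain ⟨F, I, rfl, hF, _⟩ := h.exists_cons
  obtain ⟨G, J, rfl, hG, _⟩ := h'.exists_cons
  rw [headGroup_inl, headGroup_inr]
  intro e
  have hm : Sum.inl F ∈ ((F :: I).take r.1).map Sum.inl ++ [(Sum.inr G : OBlock)] :=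
    e ▸ List.mem_cons_self
  have hm' : F ∈ (F :: I).take r.1 := by
    rcases List.mem_append.1 hm with h | h
    · obtain ⟨_, h, e⟩ := List.mem_map.1 h
      exact Sum.inl_injective e ▸ h
    · simp at h
  exact h'.2.2.1 F hm' hF

theorem place_headGroup_inl {I J : List (Finset ℕ)} (hIJ : Compatible I J) {a : ℕ} {q : ℕ × ℕ}
    (hq : q.1 + q.2 = a) (h : IsHeadGroup I J q) (w : SWord) (K : List (List OBlock)) :
    superShuffleSign (headGroup I J (.inl q) :: K) *
        place ((true, a) :: w) (superShuffleBlocks (headGroup I J (.inl q) :: K)) =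
      superShuffleSign K * place w (superShuffleBlocks K) := by
  obtain ⟨F, I, rfl, hF, hc⟩ := h.exists_cons
  have hcard := card_union_foldr h.2.2 (fun B hB => hIJ.right B (List.mem_of_mem_take hB))
    fun B hB => hIJ.inter F (by simp) B (List.mem_of_mem_take hB)
  rw [superShuffleBlocks_cons, place, headGroup_inl, groupSet_inl_cons, if_pos]
  · congr 1
    rw [superShuffleSign, superShuffleSign, List.flatten_cons, List.cons_append, inversions,
      inversions_map_inr_append h.2.2.1]
  · refine ⟨mem_union_left _ hF, ?_⟩
    rw [hcard, hc, List.length_take, min_eq_left h.2.1]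
    omega

theorem place_headGroup_inr {I J : List (Finset ℕ)} (hIJ : Compatible I J) {a : ℕ} {q : ℕ × ℕ}
    (hq : q.1 + q.2 = a) (h : IsHeadGroup J I q.swap) (w : SWord) {K : List (List OBlock)}
    (hK : K ∈ superShufflesOf (I.drop q.1) J.tail) :
    superShuffleSign (headGroup I J (.inr q) :: K) *
        place ((true, a) :: w) (superShuffleBlocks (headGroup I J (.inr q) :: K)) =
      (-1) ^ (I.drop q.1).countP (fun B => decide (Fermionic B)) *
        (superShuffleSign K * place w (superShuffleBlocks K)) := by
  obtain ⟨F, J, rfl, hF, hc⟩ := h.exists_cons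
  simp only [Prod.fst_swap] at hc
  have hcard := card_union_foldr h.2.2 (fun B hB => hIJ.left B (List.mem_of_mem_take hB))
    fun B hB => inter_comm B F ▸ hIJ.inter B (List.mem_of_mem_take hB) F (by simp)
  rw [superShuffleBlocks_cons, place, headGroup_inr, groupSet_append_inr, if_pos]
  · rw [← mul_assoc, superShuffleSign, superShuffleSign, List.flatten_cons, List.append_assoc,
      inversions_map_inl_append, List.singleton_append, inversions, if_pos hF, pow_add]
    have hl := (mem_superShufflesOf.1 hK).1
    rw [lefts] at hl
    rw [hl]
  · refine ⟨mem_union_left _ hF, ?_⟩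
    rw [Prod.snd_swap] at hcard
    rw [hcard, hc, List.length_take, min_eq_left (show q.1 ≤ I.length from h.2.1)]
    omega

open Classical in
/-- Decomposition of the super-shuffles the first group of which meets a `θ`. -/
theorem sum_superShufflesOf_theta {I J : List (Finset ℕ)} (hIJ : Compatible I J) (a : ℕ)
    (w : SWord) :
    ∑ K ∈ superShufflesOf I J, superShuffleSign K *
        place ((true, a) :: w) (superShuffleBlocks K) =
      (∑ q ∈ antidiagonal a, if IsHeadGroup I J q then
        ∑ K ∈ superShufflesOf I.tail (J.drop q.2),
          superShuffleSign K * place w (superShuffleBlocks K) else 0) +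
      ∑ q ∈ antidiagonal a, if IsHeadGroup J I q.swap then
        (-1) ^ (I.drop q.1).countP (fun B => decide (Fermionic B)) *
          ∑ K ∈ superShufflesOf (I.drop q.1) J.tail,
            superShuffleSign K * place w (superShuffleBlocks K) else 0 := by
  rw [← sum_filter, ← sum_filter]
  rw [sum_superShufflesOf (((antidiagonal a).filter (IsHeadGroup I J)).disjSum
      ((antidiagonal a).filter fun q => IsHeadGroup J I q.swap)) (headGroup I J)
    (Sum.elim (fun _ => I.tail) fun q => I.drop q.1)
    (Sum.elim (fun q => J.drop q.2) fun _ => J.tail), sum_disjSum]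
  · congr 1
    · refine sum_congr rfl fun q hq => sum_congr rfl fun K _ => ?_
      rw [mem_filter, HasAntidiagonal.mem_antidiagonal] at hq
      exact place_headGroup_inl hIJ hq.1 hq.2 w K
    · refine sum_congr rfl fun q hq => ?_
      rw [mem_filter, HasAntidiagonal.mem_antidiagonal] at hq
      rw [mul_sum]
      exact sum_congr rfl fun K hK => place_headGroup_inr hIJ hq.1 hq.2 w hK
  · rintro (q | q) hq
    · rw [inl_mem_disjSum, mem_filter] at hq
      refine ⟨isGroup_headGroup_inl hq.2, ?_, ?_⟩
      · simp only [headGroup, Sum.elim_inl, lefts_map_append_map]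
        rw [← List.drop_one, List.take_append_drop]
      · simp only [headGroup, Sum.elim_inl, rights_map_append_map, List.take_append_drop]
    · rw [inr_mem_disjSum, mem_filter] at hq
      refine ⟨isGroup_headGroup_inr hq.2, ?_, ?_⟩
      · simp only [headGroup, Sum.elim_inr, lefts_map_append_map, List.take_append_drop]
      · simp only [headGroup, Sum.elim_inr, rights_map_append_map]
        rw [← List.drop_one, List.take_append_drop]
  · rintro (q | q) hq (r | r) hr e
    · rw [mem_coe, inl_mem_disjSum, mem_filter, HasAntidiagonal.mem_antidiagonal] at hq hr
      have h2 : q.2 = r.2 := by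
        have := congrArg (fun g => (rights g).length) e
        simpa only [headGroup, Sum.elim_inl, rights_map_append_map, List.length_take,
          min_eq_left hq.2.2.1, min_eq_left hr.2.2.1] using this
      exact congrArg _ (Prod.ext (by omega) h2)
    · rw [mem_coe, inl_mem_disjSum, mem_filter] at hq
      rw [mem_coe, inr_mem_disjSum, mem_filter] at hr
      exact absurd e (headGroup_inl_ne_inr hq.2 hr.2)
    · rw [mem_coe, inr_mem_disjSum, mem_filter] at hq
      rw [mem_coe, inl_mem_disjSum, mem_filter] at hr
      exact absurd e.symm (headGroup_inl_ne_inr hr.2 hq.2)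
    · rw [mem_coe, inr_mem_disjSum, mem_filter, HasAntidiagonal.mem_antidiagonal] at hq hr
      have h1 : q.1 = r.1 := by
        have := congrArg (fun g => (lefts g).length) e
        have hq' : q.1 ≤ I.length := hq.2.2.1
        have hr' : r.1 ≤ I.length := hr.2.2.1
        simpa only [headGroup, Sum.elim_inr, lefts_map_append_map, List.length_take,
          min_eq_left hq', min_eq_left hr'] using this
      exact congrArg _ (Prod.ext h1 (by omega))
  · intro K hK hne
    cases K with
    | nil => simp [superShuffleBlocks, place] at hne
    | cons g K =>
      rw [superShuffleBlocks_cons, place] at hne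
      have hg : Fermionic (groupSet g) ∧ (groupSet g).card = a + 1 := by
        by_contra h
        simp [h] at hne
      obtain ⟨h1, I', J', rfl, rfl, _⟩ := cons_mem_superShufflesOf.1 hK
      rcases isGroup_iff.1 h1 with ⟨B, hB, rfl | rfl⟩ | ⟨F, s, hF, hs, rfl⟩ | ⟨F, s, hF, hs, rfl⟩
      · rw [groupSet_singleton] at hg
        exact absurd hg.1 hB
      · rw [groupSet_singleton] at hg
        exact absurd hg.1 hB
      · have hl : lefts (Sum.inl F :: s.map Sum.inr) = [F] := lefts_map_append_map [F] s
        have hr : rights (Sum.inl F :: s.map Sum.inr) = s := rights_map_append_map [F] s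
        rw [hl, hr] at hIJ ⊢
        rw [groupSet_inl_cons, card_union_foldr hs (fun B hB => hIJ.right B (by simp [hB]))
          fun B hB => hIJ.inter F (by simp) B (by simp [hB])] at hg
        refine ⟨.inl (F.card - 1, s.length), ?_, K, ?_⟩
        · have : 0 < F.card := card_pos.2 ⟨0, hF⟩
          rw [inl_mem_disjSum, mem_filter, HasAntidiagonal.mem_antidiagonal]
          exact ⟨by simp only; omega, isHeadGroup_cons_append hF hs I' J'⟩
        · rw [List.singleton_append, headGroup_inl, List.take_left]
      · have hl : lefts (s.map Sum.inl ++ [Sum.inr F]) = s := lefts_map_append_map s [F]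
        have hr : rights (s.map Sum.inl ++ [Sum.inr F]) = [F] := rights_map_append_map s [F]
        rw [hl, hr] at hIJ ⊢
        rw [groupSet_append_inr, card_union_foldr hs (fun B hB => hIJ.left B (by simp [hB]))
          fun B hB => inter_comm B F ▸ hIJ.inter B (by simp [hB]) F (by simp)] at hg
        refine ⟨.inr (s.length, F.card - 1), ?_, K, ?_⟩
        · have : 0 < F.card := card_pos.2 ⟨0, hF⟩
          rw [inr_mem_disjSum, mem_filter, HasAntidiagonal.mem_antidiagonal]
          exact ⟨by simp only; omega, isHeadGroup_cons_append hF hs J' I'⟩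
        · rw [List.singleton_append, headGroup_inr, List.take_left]

/-! ### The product rule -/

theorem superShufflesOf_nil_nil : superShufflesOf [] [] = {[]} := by
  ext K
  rw [mem_superShufflesOf, mem_singleton]
  constructor
  · rintro ⟨h1, h2, h3⟩
    cases K with
    | nil => rfl
    | cons g K =>
      have hlen := length_eq_of_isShuffle (g :: K).flatten
      have h4 := (length_flatten_le (g :: K) h3).1
      rw [lefts] at h1
      rw [rights] at h2
      rw [h1, h2] at hlen
      rw [hlen] at h4
      simp at h4
  · rintro rfl
    simp

/-- The product rule for the coefficients of a monomial, by induction on its variables. -/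
theorem mulWord_place (w : SWord) : ∀ I J, Compatible I J →
    mulWord w (fun v => place v I) (fun v => place v J) =
      ∑ K ∈ superShufflesOf I J, superShuffleSign K * place w (superShuffleBlocks K) := by
  classical
  induction w with
  | nil =>
    intro I J h
    by_cases hIJ : I = [] ∧ J = []
    · obtain ⟨rfl, rfl⟩ := hIJ
      simp [superShufflesOf_nil_nil, mulWord, place, superShuffleSign, inversions,
        superShuffleBlocks]
    · rw [sum_eq_zero]
      · cases I with
        | nil =>
          cases J with
          | nil => simp at hIJ
          | cons C J => simp [mulWord, place]
        | cons B I => simp [mulWord, place]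
      · intro K hK
        cases K with
        | nil =>
          obtain ⟨rfl, rfl, -⟩ := mem_superShufflesOf.1 hK
          simp at hIJ
        | cons g K => rw [superShuffleBlocks_cons, place, mul_zero]
  | cons p w ih =>
    intro I J h
    obtain ⟨_ | _, a⟩ := p
    · exact mulRun_eq_shuffleRun ih a ∅ I J h
    · rw [sum_superShufflesOf_theta h, mulWord, ← sum_add_distrib]
      refine sum_congr rfl fun q _ => ?_
      rw [← ih _ _ (h.mono I.tail_subset (List.drop_subset _ J)),
        ← ih _ _ (h.mono (List.drop_subset _ I) J.tail_subset),
        ← mulWord_theta_left, ← mulWord_theta_right]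
      rfl

/-! ### Shifted blocks -/

theorem fermionic_shiftBlock {n : ℕ} {B : Finset ℕ} : Fermionic (shiftBlock n B) ↔ Fermionic B := by
  simp only [Fermionic, shiftBlock, mem_image]
  constructor
  · rintro ⟨a, ha, h⟩
    split_ifs at h with h0
    · exact h0 ▸ ha
    · omega
  · exact fun h => ⟨0, h, if_pos rfl⟩

theorem card_shiftBlock (n : ℕ) (B : Finset ℕ) : (shiftBlock n B).card = B.card := by
  refine card_image_of_injective B fun a b h => ?_
  change (if a = 0 then 0 else a + n) = if b = 0 then 0 else b + n at h
  split_ifs at h <;> omega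

theorem below_shiftBlock {n : ℕ} {B C : Finset ℕ} (hB : ¬ Fermionic B) (hC : ¬ Fermionic C) :
    Below (shiftBlock n B) (shiftBlock n C) ↔ Below B C := by
  simp only [Below, shiftBlock, forall_mem_image]
  refine forall₂_congr fun b hb => forall₂_congr fun c hc => ?_
  have hb0 : b ≠ 0 := ne_of_mem_of_not_mem hb hB
  have hc0 : c ≠ 0 := ne_of_mem_of_not_mem hc hC
  rw [if_neg hb0, if_neg hc0]
  omega

theorem gammaBlocks_map_shiftBlock (n : ℕ) (s : List (Finset ℕ)) :
    gammaBlocks (s.map (shiftBlock n)) = gammaBlocks s := by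
  induction s with
  | nil => rfl
  | cons B s ih =>
    rw [List.map_cons]
    by_cases hB : Fermionic B
    · rw [gammaBlocks_cons_fermionic hB, gammaBlocks_cons_fermionic (fermionic_shiftBlock.2 hB),
        card_shiftBlock, ih]
    · have hB' : ¬ Fermionic (shiftBlock n B) := fermionic_shiftBlock.not.2 hB
      cases s with
      | nil =>
        rw [gammaBlocks_cons_of_not hB (by simp), List.map_nil,
          gammaBlocks_cons_of_not hB' (by simp)]
      | cons C s =>
        by_cases h : ¬ Fermionic C ∧ Below B C
        · obtain ⟨k, t, h1, h2⟩ := gammaBlocks_cons_of_below hB h.1 h.2 s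
          obtain ⟨k', t', h1', h2'⟩ := gammaBlocks_cons_of_below hB'
            (fermionic_shiftBlock.not.2 h.1) ((below_shiftBlock hB h.1).2 h.2)
            (s.map (shiftBlock n))
          rw [List.map_cons, h1, h1'] at ih
          simp only [List.cons.injEq, DottedPart.plain.injEq] at ih
          rw [List.map_cons, h2, h2', ih.1, ih.2]
        · rw [gammaBlocks_cons_of_not hB (by simpa using h), gammaBlocks_cons_of_not hB', ih]
          intro D hD
          simp only [List.map_cons, List.head?_cons, Option.mem_def, Option.some.injEq] at hD
          subst hD
          rintro ⟨h1, h2⟩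
          have h1' := fermionic_shiftBlock.not.1 h1
          exact h ⟨h1', (below_shiftBlock hB h1').1 h2⟩

theorem compatible_shiftBlock {I J : SetSupercomposition} (hI : I.IsSuperpermutation)
    (hJ : J.IsSuperpermutation) : Compatible I.blocks (J.blocks.map (shiftBlock I.n)) := by
  refine ⟨hI, ?_, ?_⟩
  · simp only [List.forall_mem_map, fermionic_shiftBlock, card_shiftBlock]
    exact hJ
  · simp only [List.forall_mem_map]
    intro B hB C _ x hx
    rw [mem_inter, shiftBlock, mem_image] at hx
    obtain ⟨hxB, c, _, rfl⟩ := hx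
    rw [mem_singleton]
    by_contra h0
    have hle := (I.union _ h0).1 ⟨B, hB, hxB⟩
    split_ifs at hle h0 <;> omega

theorem fundamental_mul_fundamental {I J : SetSupercomposition} (hI : I.IsSuperpermutation)
    (hJ : J.IsSuperpermutation) :
    fundamental I.gamma * fundamental J.gamma = ∑ K ∈ superShuffles I J,
      superShuffleSign K • fundamental (gammaBlocks (superShuffleBlocks K)) := by
  refine Subtype.ext (funext fun u => ?_)
  obtain ⟨w, rfl⟩ := SWord.monomial_surjective u
  rw [AddSubmonoidClass.coe_finsetSum, Finset.sum_apply, superShuffles_eq]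
  change mulCoeff (fundamental (gammaBlocks I.blocks)).1 (fundamental (gammaBlocks J.blocks)).1 _ = _
  rw [← gammaBlocks_map_shiftBlock I.n J.blocks, mulCoeff_monomial]
  simp only [fundamental_gammaBlocks_apply]
  rw [mulWord_place w _ _ (compatible_shiftBlock hI hJ)]
  refine sum_congr rfl fun K _ => ?_
  rw [← fundamental_gammaBlocks_apply]
  rfl

end SuperQSym

theorem theorem2 (α β : SuperQSym.DottedComposition) :
    (∀ I J : SuperQSym.SetSupercomposition,
      I.IsSuperpermutation → J.IsSuperpermutation → I.gamma = α → J.gamma = β →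
        SuperQSym.fundamental α * SuperQSym.fundamental β =
          ∑ K ∈ SuperQSym.superShuffles I J, SuperQSym.superShuffleSign K •
            SuperQSym.fundamental
              (SuperQSym.gammaBlocks (SuperQSym.superShuffleBlocks K))) ∧
    (∀ I J I' J' : SuperQSym.SetSupercomposition,
      I.IsSuperpermutation → J.IsSuperpermutation → I.gamma = α → J.gamma = β →
      I'.IsSuperpermutation → J'.IsSuperpermutation → I'.gamma = α → J'.gamma = β →
        ∑ K ∈ SuperQSym.superShuffles I J, SuperQSym.superShuffleSign K •
            SuperQSym.fundamental
              (SuperQSym.gammaBlocks (SuperQSym.superShuffleBlocks K)) =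
          ∑ K ∈ SuperQSym.superShuffles I' J', SuperQSym.superShuffleSign K •
            SuperQSym.fundamental
              (SuperQSym.gammaBlocks (SuperQSym.superShuffleBlocks K))) := by
  have h : ∀ I J : SuperQSym.SetSupercomposition, I.IsSuperpermutation → J.IsSuperpermutation →
      I.gamma = α → J.gamma = β →
        SuperQSym.fundamental α * SuperQSym.fundamental β =
          ∑ K ∈ SuperQSym.superShuffles I J, SuperQSym.superShuffleSign K •
            SuperQSym.fundamental
              (SuperQSym.gammaBlocks (SuperQSym.superShuffleBlocks K)) := by
    rintro I J hI hJ rfl rfl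
    exact SuperQSym.fundamental_mul_fundamental hI hJ
  exact ⟨h, fun I J I' J' hI hJ hα hβ hI' hJ' hα' hβ' =>
    (h I J hI hJ hα hβ).symm.trans (h I' J' hI' hJ' hα' hβ')⟩
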